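/- **Setting.** Let $\mathcal M=\mathbb R^4$ be Minkowski space-time, with product $k\cdot x=k^0x^0-k^1x^1-k^2x^2-k^3x^3$, let $V=\{k: k^0>0,\ k\cdot k>0\}$ be the open future cone, and for $k\in V$ put $\mu=\sqrt{k\cdot k}$, $q(\mu)=(\mu,0,0,0)$. For $a\in SL(2,\mathbb C)$ let $\Lambda(a)$ be the corresponding Lorentz matrix, and for $k\in V$ let $a_k\in SL(2,\mathbb C)$ be the pure boost with $k=\Lambda(a_k)q(\mu)$. Let $R^j$ denote the $(2j+1)$-dimensional unitary irreducible representation of $SU(2)$, $j=0,\frac12,1,\dots$ Let $\sigma$ range over a countable set and let $\Delta_{\sigma j}\subset\mathbb R$ be Borel sets (the mass spectra). Let $\mathcal H$ be the separable Hilbert space of wave functions $\psi_{\sigma jm}(\mu,a)$, $\mu>0$, $a\in SL(2,\mathbb C)$, $m=-j,\dots,j$, that satisfy the covariance condition $$\psi_{\sigma jm}(\mu,au)=\sum_{m'}R^j_{mm'}(u^{-1})\,\psi_{\sigma jm'}(\mu,a)\qquad(u\in SU(2)),$$ vanish for $\mu\notin\Delta_{\sigma j}$, and have finite norm $$\|\psi\|^2=\int_V\sum_{\sigma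 jm}|\psi_{\sigma jm}(\mu,a_k)|^2\,d^4k .$$ The universal covering of the proper orthochronous Poincaré group, with elements $(x,b)$, $x\in\mathbb R^4$, $b\in SL(2,\mathbb C)$, acts on $\mathcal H$ by the unitary representation $$[U(x,b)\psi]_{\sigma jm}(\mu,a)=e^{ik\cdot x}\,\psi_{\sigma jm}(\mu,b^{-1}a),\qquad k=\Lambda(a)q(\mu).$$ Let $\mathcal D\subset\mathcal H$ be the linear subspace of those $\psi$ for which the functions $k\mapsto\psi_{\sigma jm}(\mu,a_k)$ are $C^\infty$ with compact support in $V$ and are non-zero only for finitely many indices $\sigma,j,m$. **Proposition.** Let $\tau$ be a normalized positive-operator-valued measure on the Borel sets of $\mathcal M$ with values in the bounded operators on $\mathcal H$ ($\tau(\mathcal M)=1$), covariant under the Poincaré group: $$U(x,b)^\dagger\,\tau(\Lambda(b)I+x)\,U(x,b)=\tau(I)\qquad\text{for all }x,b\text{ and all Borel sets }I .$$ Then for all $\psi,\phi\in\mathcal D$ there is an infinitely differentiable, integrable function $x\mapsto\rho(\psi,\phi,x)$ on $\mathcal M$ with $$(\psi,\tau(I)\phi)=\int_I\rho(\psi,\phi,x)\,d^4x\qquad\text{for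 every Borel set }I\subset\mathcal M .$$ In particular $(\psi,\tau(I)\psi)=\int_I\rho(\psi,x)\,d^4x$, where $\rho(\psi,x)=\rho(\psi,\psi,x)$ is real and $\rho(\psi,x)\ge0$ for all $x$. -/

import Mathlib

open scoped Matrix ContDiff

namespace QEvent

/-- Complex `2 × 2` matrices. -/
abbrev Mat2 := Matrix (Fin 2) (Fin 2) ℂ

/-- The matrix of the spin `j = n / 2` representation on binary forms of degree `n`:
`(R(u) p)(z) = p(z u)` for a row vector `z = (z₁, z₂)`, in the basis
`e_p = z₁ ^ p z₂ ^ (n - p) / √(p! (n - p)!)`, `p = j + m = 0, …, n`, which is orthonormal for the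
`SU(2)`-invariant scalar product. (The coefficients are read off at `z = (X, 1)`.)
Restricted to `SU(2)` it is the unitary irreducible representation `R^j` of dimension
`2 j + 1 = n + 1`. -/
noncomputable def spinRep (n : ℕ) (u : Mat2) : Matrix (Fin (n + 1)) (Fin (n + 1)) ℂ :=
  Matrix.of fun q p =>
    ((Real.sqrt ((q : ℕ).factorial * (n - q : ℕ).factorial) /
      Real.sqrt ((p : ℕ).factorial * (n - p : ℕ).factorial) : ℝ) : ℂ) *
    ((Polynomial.C (u 0 0) * Polynomial.X + Polynomial.C (u 1 0)) ^ (p : ℕ) *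
      (Polynomial.C (u 0 1) * Polynomial.X + Polynomial.C (u 1 1)) ^ (n - p : ℕ)).coeff q

/-- The normalized monomials `z₁ ^ p z₂ ^ (n - p) / √(p! (n - p)!)`. -/
noncomputable def binaryMonomial (n : ℕ) (z : Fin 2 → ℂ) : Fin (n + 1) → ℂ := fun p =>
  ((Real.sqrt ((p : ℕ).factorial * (n - p : ℕ).factorial) : ℝ) : ℂ)⁻¹ *
    (z 0 ^ (p : ℕ) * z 1 ^ (n - p : ℕ))

lemma wt_ne (n p : ℕ) : ((Real.sqrt (p.factorial * (n - p).factorial) : ℝ) : ℂ) ≠ 0 := by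
  have : 0 < Real.sqrt (p.factorial * (n - p).factorial) := Real.sqrt_pos.mpr (by positivity)
  exact_mod_cast this.ne'

lemma binary_form_sum (u : Mat2) {n p : ℕ} (hp : p ≤ n) (z : Fin 2 → ℂ) :
    ∑ q : Fin (n + 1),
      ((Polynomial.C (u 0 0) * Polynomial.X + Polynomial.C (u 1 0)) ^ p *
        (Polynomial.C (u 0 1) * Polynomial.X + Polynomial.C (u 1 1)) ^ (n - p)).coeff q *
        (z 0 ^ (q : ℕ) * z 1 ^ (n - q : ℕ)) =
    (z 0 * u 0 0 + z 1 * u 1 0) ^ p * (z 0 * u 0 1 + z 1 * u 1 1) ^ (n - p) := by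
  set f := (Polynomial.C (u 0 0) * Polynomial.X + Polynomial.C (u 1 0)) ^ p *
        (Polynomial.C (u 0 1) * Polynomial.X + Polynomial.C (u 1 1)) ^ (n - p) with hf
  have hdeg : f.natDegree < n + 1 := by
    have h1 : ((Polynomial.C (u 0 0) * Polynomial.X + Polynomial.C (u 1 0)) ^ p).natDegree ≤ p := by
      simpa using Polynomial.natDegree_pow_le_of_le p
        (Polynomial.natDegree_linear_le (a := u 0 0) (b := u 1 0))
    have h2 : ((Polynomial.C (u 0 1) * Polynomial.X + Polynomial.C (u 1 1)) ^ (n - p)).natDegree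
        ≤ n - p := by
      simpa using Polynomial.natDegree_pow_le_of_le (n - p)
        (Polynomial.natDegree_linear_le (a := u 0 1) (b := u 1 1))
    have := Polynomial.natDegree_mul_le_of_le h1 h2
    rw [← hf] at this
    omega
  have key : ∀ s t : ℂ, t ≠ 0 → ∑ q : Fin (n + 1), f.coeff q * (s ^ (q : ℕ) * t ^ (n - q : ℕ)) =
      (s * u 0 0 + t * u 1 0) ^ p * (s * u 0 1 + t * u 1 1) ^ (n - p) := by
    intro s t ht
    have he : f.eval (s / t) * t ^ n =
        (s * u 0 0 + t * u 1 0) ^ p * (s * u 0 1 + t * u 1 1) ^ (n - p) := by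
      have e : t ^ n = t ^ p * t ^ (n - p) := by rw [← pow_add]; congr 1; omega
      rw [hf, e]
      simp only [Polynomial.eval_mul, Polynomial.eval_pow, Polynomial.eval_add, Polynomial.eval_C,
        Polynomial.eval_X]
      rw [show ∀ a b c d : ℂ, a * b * (c * d) = (a * c) * (b * d) by intros; ring, ← mul_pow,
        ← mul_pow]
      congr 2 <;> field_simp
    rw [← he, Polynomial.eval_eq_sum_range' hdeg, Finset.sum_mul, Finset.sum_range]
    refine Finset.sum_congr rfl fun q _ => ?_
    have hq : (q : ℕ) ≤ n := by omega
    have ht' : t ^ n = t ^ (n - q : ℕ) * t ^ (q : ℕ) := by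
      rw [← pow_add, Nat.sub_add_cancel hq]
    rw [div_pow, ht']
    field_simp
  have hc : (fun t : ℂ => ∑ q : Fin (n + 1), f.coeff q * (z 0 ^ (q : ℕ) * t ^ (n - q : ℕ))) =
      fun t => (z 0 * u 0 0 + t * u 1 0) ^ p * (z 0 * u 0 1 + t * u 1 1) ^ (n - p) := by
    refine Continuous.ext_on (dense_compl_singleton (0 : ℂ)) (by fun_prop) (by fun_prop) ?_
    intro t ht
    exact key _ _ ht
  exact congrFun hc (z 1)

lemma binaryMonomial_vecMul (n : ℕ) (u : Mat2) (z : Fin 2 → ℂ) :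
    Matrix.vecMul (binaryMonomial n z) (spinRep n u) = binaryMonomial n (Matrix.vecMul z u) := by
  funext p
  have h := binary_form_sum u (show (p : ℕ) ≤ n by omega) z
  have hz0 : Matrix.vecMul z u 0 = z 0 * u 0 0 + z 1 * u 1 0 := by
    simp [Matrix.vecMul, dotProduct, Fin.sum_univ_two]
  have hz1 : Matrix.vecMul z u 1 = z 0 * u 0 1 + z 1 * u 1 1 := by
    simp [Matrix.vecMul, dotProduct, Fin.sum_univ_two]
  simp only [binaryMonomial, hz0, hz1]
  rw [← h, Finset.mul_sum]
  simp only [Matrix.vecMul, dotProduct, spinRep, Matrix.of_apply, binaryMonomial, Complex.ofReal_div]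
  refine Finset.sum_congr rfl fun q _ => ?_
  have h1 := wt_ne n q
  have h2 := wt_ne n p
  field_simp

lemma binaryMonomial_sep (n : ℕ) (v w : Fin (n + 1) → ℂ)
    (h : ∀ z : Fin 2 → ℂ, binaryMonomial n z ⬝ᵥ v = binaryMonomial n z ⬝ᵥ w) : v = w := by
  have key : (∑ p : Fin (n + 1), Polynomial.monomial (p : ℕ)
      (((Real.sqrt ((p : ℕ).factorial * (n - p : ℕ).factorial) : ℝ) : ℂ)⁻¹ * v p)) =
      ∑ p : Fin (n + 1), Polynomial.monomial (p : ℕ)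
      (((Real.sqrt ((p : ℕ).factorial * (n - p : ℕ).factorial) : ℝ) : ℂ)⁻¹ * w p) := by
    refine Polynomial.funext fun t => ?_
    have := h ![t, 1]
    simp only [binaryMonomial, dotProduct, Matrix.cons_val_zero, Matrix.cons_val_one, one_pow, mul_one]
      at this
    simp only [Polynomial.eval_finsetSum, Polynomial.eval_monomial]
    convert this using 2 <;> ring
  funext p
  have := congrArg (fun f => Polynomial.coeff f (p : ℕ)) key
  simp only [Polynomial.finsetSum_coeff, Polynomial.coeff_monomial, Fin.val_inj,
    Finset.sum_ite_eq', Finset.mem_univ, if_true] at this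
  exact mul_left_cancel₀ (inv_ne_zero (wt_ne n p)) this

lemma binaryMonomial_sep_matrix (n : ℕ) (A B : Matrix (Fin (n + 1)) (Fin (n + 1)) ℂ)
    (h : ∀ z, Matrix.vecMul (binaryMonomial n z) A = Matrix.vecMul (binaryMonomial n z) B) : A = B := by
  ext q p
  have := binaryMonomial_sep n (fun q => A q p) (fun q => B q p) fun z => congrFun (h z) p
  exact congrFun this q

lemma spinRep_mul (n : ℕ) (u v : Mat2) : spinRep n (u * v) = spinRep n u * spinRep n v := by
  refine binaryMonomial_sep_matrix n _ _ fun z => ?_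
  rw [← Matrix.vecMul_vecMul, binaryMonomial_vecMul, binaryMonomial_vecMul, binaryMonomial_vecMul, Matrix.vecMul_vecMul]

lemma spinRep_one (n : ℕ) : spinRep n 1 = 1 := by
  refine binaryMonomial_sep_matrix n _ _ fun z => ?_
  rw [binaryMonomial_vecMul, Matrix.vecMul_one, Matrix.vecMul_one]

lemma binaryMonomial_kernel (n : ℕ) (z w : Fin 2 → ℂ) :
    binaryMonomial n z ⬝ᵥ star (binaryMonomial n w) = (n.factorial : ℂ)⁻¹ * (z ⬝ᵥ star w) ^ n := by
  have h2 : z ⬝ᵥ star w = z 0 * star (w 0) + z 1 * star (w 1) := by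
    simp [dotProduct, Fin.sum_univ_two]
  rw [h2, add_pow, Finset.mul_sum, Finset.sum_range]
  simp only [dotProduct]
  refine Finset.sum_congr rfl fun p _ => ?_
  have hp : (p : ℕ) ≤ n := by omega
  have hs : (((Real.sqrt ((p : ℕ).factorial * (n - p : ℕ).factorial) : ℝ) : ℂ)) ^ 2 =
      ((p : ℕ).factorial * (n - p : ℕ).factorial : ℂ) := by
    rw [← Complex.ofReal_pow, Real.sq_sqrt (by positivity)]
    push_cast; rfl
  have hch : ((n.choose p : ℕ) : ℂ) * ((p : ℕ).factorial * (n - p : ℕ).factorial) =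
      n.factorial := by
    rw [← mul_assoc]; exact_mod_cast Nat.choose_mul_factorial_mul_factorial hp
  have hw := wt_ne n p
  have hn : (n.factorial : ℂ) ≠ 0 := by exact_mod_cast n.factorial_ne_zero
  simp only [binaryMonomial, Pi.star_apply, star_mul', star_inv₀, star_pow, RCLike.star_def,
    Complex.conj_ofReal]
  rw [← hs] at hch
  rw [← hch] at hn ⊢
  have hcc : ((n.choose p : ℕ) : ℂ) ≠ 0 := left_ne_zero_of_mul hn
  field_simp
  ring

lemma spinRep_conjTranspose (n : ℕ) (u : Mat2) : spinRep n u.conjTranspose = (spinRep n u).conjTranspose := by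
  refine binaryMonomial_sep_matrix n _ _ fun z => ?_
  have : star (Matrix.vecMul (binaryMonomial n z) (spinRep n u.conjTranspose)) =
      star (Matrix.vecMul (binaryMonomial n z) (spinRep n u).conjTranspose) := by
    refine binaryMonomial_sep n _ _ fun w => ?_
    have e1 := binaryMonomial_kernel n w (Matrix.vecMul z u.conjTranspose)
    have e2 := binaryMonomial_kernel n (Matrix.vecMul w u) z
    rw [Matrix.star_vecMul, Matrix.conjTranspose_conjTranspose, Matrix.dotProduct_mulVec] at e1
    rw [binaryMonomial_vecMul, e1, Matrix.star_vecMul, Matrix.conjTranspose_conjTranspose,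
      Matrix.dotProduct_mulVec, binaryMonomial_vecMul, e2]
  exact star_injective this

lemma spinRep_unitary (n : ℕ) {u : Mat2} (hu : u.conjTranspose * u = 1) :
    (spinRep n u).conjTranspose * spinRep n u = 1 := by
  rw [← spinRep_conjTranspose, ← spinRep_mul, hu, spinRep_one]

/-- Minkowski space-time, and also four-momentum space, with coordinates `0, 1, 2, 3`.
The measure `volume` on it is Lebesgue measure. -/
abbrev Spacetime := Fin 4 → ℝ

/-- The Minkowski product, of signature `(+, -, -, -)`. -/
def mink (x y : Spacetime) : ℝ := x 0 * y 0 - x 1 * y 1 - x 2 * y 2 - x 3 * y 3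

/-- The open future cone `V`. -/
def futureCone : Set Spacetime := {k | 0 < k 0 ∧ 0 < mink k k}

/-- The mass `μ = √(k · k)` of a four-momentum. -/
noncomputable def mass (k : Spacetime) : ℝ := Real.sqrt (mink k k)

/-- The four-momentum `q(μ) = (μ, 0, 0, 0)`. -/
def restMomentum (μ : ℝ) : Spacetime := ![μ, 0, 0, 0]

/-- The group `SL(2, ℂ)`. -/
abbrev SL2C := Matrix.SpecialLinearGroup (Fin 2) ℂ

/-- The Hermitian matrix `x⁰ + x¹ σ₁ + x² σ₂ + x³ σ₃`. -/
def hermMat (x : Spacetime) : Mat2 :=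
  !![(x 0 : ℂ) + x 3, (x 1 : ℂ) - Complex.I * x 2; (x 1 : ℂ) + Complex.I * x 2, (x 0 : ℂ) - x 3]

/-- The Lorentz matrix `Λ(a)`: `Λ(a)_{αβ} = ½ tr (σ_α a σ_β a†)`, that is,
`hermMat (Λ(a) x) = a (hermMat x) a†` (see `hermMat_lorentz`). -/
noncomputable def lorentz (a : Mat2) : Matrix (Fin 4) (Fin 4) ℝ :=
  Matrix.of fun α β => (1 / 2) *
    (hermMat (Pi.single α 1) * (a * hermMat (Pi.single β 1) * a.conjTranspose)).trace.re

lemma hermMat_conjTranspose (x : Spacetime) : (hermMat x).conjTranspose = hermMat x := by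
  ext i j
  fin_cases i <;> fin_cases j <;> apply Complex.ext <;> simp [hermMat]

lemma hermMat_eq_sum (x : Spacetime) :
    hermMat x = ∑ β, (x β : ℂ) • hermMat (Pi.single β 1) := by
  ext i j
  fin_cases i <;> fin_cases j <;>
    simp [hermMat, Fin.sum_univ_four, Pi.single_apply] <;> ring

lemma hermMat_coord {M : Mat2} (hM : M.conjTranspose = M) :
    hermMat (fun α => (1 / 2) * (hermMat (Pi.single α 1) * M).trace.re) = M := by
  have h (i j : Fin 2) : star (M j i) = M i j := congrFun (congrFun hM i) j
  have hr (i j : Fin 2) : (M j i).re = (M i j).re := by rw [← h i j]; simp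
  have hi (i j : Fin 2) : -(M j i).im = (M i j).im := by rw [← h i j]; simp
  have h1 := hr 0 1
  have h2 := hi 0 1
  have h3 := hi 0 0
  have h4 := hi 1 1
  ext i j
  fin_cases i <;> fin_cases j <;> apply Complex.ext <;>
    simp [hermMat, Matrix.trace_fin_two, Matrix.vecMul, dotProduct, Fin.sum_univ_two] <;>
    linarith

lemma hermMat_lorentz (a : Mat2) (x : Spacetime) :
    hermMat (lorentz a *ᵥ x) = a * hermMat x * a.conjTranspose := by
  have hM : (a * hermMat x * a.conjTranspose).conjTranspose = a * hermMat x * a.conjTranspose := by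
    rw [Matrix.conjTranspose_mul, Matrix.conjTranspose_mul, Matrix.conjTranspose_conjTranspose,
      hermMat_conjTranspose, Matrix.mul_assoc]
  rw [← hermMat_coord hM]
  congr 1
  funext α
  rw [hermMat_eq_sum x]
  simp only [lorentz, Matrix.mulVec, dotProduct, Matrix.of_apply, Matrix.sum_mul,
    Matrix.trace_sum, Complex.re_sum, Finset.mul_sum, Matrix.mul_smul, Matrix.smul_mul,
    Matrix.trace_smul, smul_eq_mul, Complex.re_ofReal_mul]
  exact Finset.sum_congr rfl fun β _ => by ring

lemma hermMat_injective : Function.Injective hermMat := by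
  intro x y h
  have h00 := congrArg Complex.re (congrFun (congrFun h 0) 0)
  have h11 := congrArg Complex.re (congrFun (congrFun h 1) 1)
  have h10 := congrFun (congrFun h 1) 0
  have h10r := congrArg Complex.re h10
  have h10i := congrArg Complex.im h10
  simp [hermMat] at h00 h11 h10r h10i
  funext i
  fin_cases i
  · simp; linarith
  · simpa using h10r
  · simpa using h10i
  · simp; linarith

lemma hermMat_det (x : Spacetime) : (hermMat x).det = (mink x x : ℝ) := by
  rw [Matrix.det_fin_two]
  simp [hermMat, mink]
  linear_combination (x 2 : ℂ) ^ 2 * Complex.I_sq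

lemma hermMat_restMomentum (μ : ℝ) : hermMat (restMomentum μ) = (μ : ℂ) • (1 : Mat2) := by
  ext i j
  fin_cases i <;> fin_cases j <;> simp [hermMat, restMomentum]

lemma lorentz_mul (a b : Mat2) : lorentz (a * b) = lorentz a * lorentz b := by
  refine Matrix.ext_of_mulVec_single fun i => ?_
  apply hermMat_injective
  rw [← Matrix.mulVec_mulVec, hermMat_lorentz, hermMat_lorentz, hermMat_lorentz,
    Matrix.conjTranspose_mul]
  simp only [Matrix.mul_assoc]

lemma lorentz_one : lorentz 1 = 1 := by
  refine Matrix.ext_of_mulVec_single fun i => ?_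
  apply hermMat_injective
  rw [hermMat_lorentz, Matrix.conjTranspose_one, Matrix.one_mul, Matrix.mul_one, Matrix.one_mulVec]

lemma mink_lorentz {a : Mat2} (ha : a.det = 1) (x : Spacetime) :
    mink (lorentz a *ᵥ x) (lorentz a *ᵥ x) = mink x x := by
  have h := congrArg Matrix.det (hermMat_lorentz a x)
  rw [Matrix.det_mul, Matrix.det_mul, Matrix.det_conjTranspose, ha, hermMat_det, hermMat_det] at h
  simpa using h

lemma mass_lorentz {a : Mat2} (ha : a.det = 1) (x : Spacetime) :
    mass (lorentz a *ᵥ x) = mass x := by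
  rw [mass, mass, mink_lorentz ha]

lemma mink_add_sub (x y : Spacetime) : 4 * mink x y =
    mink (x + y) (x + y) - mink (x - y) (x - y) := by
  simp [mink]; ring

lemma mink_lorentz_lorentz {a : Mat2} (ha : a.det = 1) (x y : Spacetime) :
    mink (lorentz a *ᵥ x) (lorentz a *ᵥ y) = mink x y := by
  have h1 := mink_add_sub (lorentz a *ᵥ x) (lorentz a *ᵥ y)
  have h2 := mink_add_sub x y
  rw [← Matrix.mulVec_add, ← Matrix.mulVec_sub, mink_lorentz ha, mink_lorentz ha] at h1
  linarith

lemma abs_det_lorentz {a : Mat2} (ha : a.det = 1) : |(lorentz a).det| = 1 := by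
  set η : Matrix (Fin 4) (Fin 4) ℝ := Matrix.diagonal ![1, -1, -1, -1] with hη
  have hm : ∀ x y : Spacetime, mink x y = x ⬝ᵥ (η *ᵥ y) := by
    intro x y
    simp [hη, mink, Matrix.mulVec_diagonal, dotProduct, Fin.sum_univ_four]
    ring
  have h : (lorentz a).transpose * η * lorentz a = η := by
    refine Matrix.ext_of_mulVec_single fun j => ?_
    refine dotProduct_eq _ _ fun x => ?_
    rw [dotProduct_comm, dotProduct_comm _ x, ← hm, ← mink_lorentz_lorentz ha, hm,
      Matrix.dotProduct_mulVec, Matrix.dotProduct_mulVec, Matrix.dotProduct_mulVec,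
      ← Matrix.vecMul_vecMul, ← Matrix.vecMul_vecMul, Matrix.vecMul_transpose]
  have hd := congrArg Matrix.det h
  rw [Matrix.det_mul, Matrix.det_mul, Matrix.det_transpose] at hd
  have hηd : η.det = -1 := by simp [hη, Matrix.det_diagonal, Fin.prod_univ_four]
  rw [hηd] at hd
  have : (lorentz a).det ^ 2 = 1 := by linarith
  rw [← sq_abs] at this
  exact (pow_eq_one_iff_of_nonneg (abs_nonneg _) two_ne_zero).mp this

/-- The element `a_k` of `SL(2, ℂ)` with `k = Λ(a_k) q(μ)` (see `lorentz_boost`), for `k` in the open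
future cone: the pure boost, i.e. the positive square root of `hermMat k / μ`.
It depends smoothly on `k`. -/
noncomputable def boost (k : Spacetime) : Mat2 :=
  ((Real.sqrt (2 * mass k * (mass k + k 0)) : ℝ) : ℂ)⁻¹ • (hermMat k + (mass k : ℂ) • 1)

lemma mass_pos {k : Spacetime} (hk : k ∈ futureCone) : 0 < mass k := Real.sqrt_pos.mpr hk.2

lemma mass_sq {k : Spacetime} (hk : k ∈ futureCone) : mass k ^ 2 = mink k k :=
  Real.sq_sqrt hk.2.le

lemma boost_conjTranspose (k : Spacetime) : (boost k).conjTranspose = boost k := by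
  rw [boost, Matrix.conjTranspose_smul, Matrix.conjTranspose_add, hermMat_conjTranspose,
    Matrix.conjTranspose_smul, Matrix.conjTranspose_one, star_inv₀]
  simp only [RCLike.star_def, Complex.conj_ofReal]

lemma boost_norm_sq {k : Spacetime} (hk : k ∈ futureCone) :
    (((Real.sqrt (2 * mass k * (mass k + k 0)) : ℝ) : ℂ)) ^ 2 =
      2 * mass k * (mass k + k 0) := by
  have := mass_pos hk
  have := hk.1
  rw [← Complex.ofReal_pow, Real.sq_sqrt (by positivity)]
  push_cast; rfl

lemma boost_scale_ne {k : Spacetime} (hk : k ∈ futureCone) :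
    (2 * mass k * (mass k + k 0) : ℂ) ≠ 0 := by
  have := mass_pos hk
  have := hk.1
  have h : 0 < 2 * mass k * (mass k + k 0) := by positivity
  exact_mod_cast h.ne'

lemma hermMat_trace (k : Spacetime) : (hermMat k).trace = 2 * (k 0 : ℂ) := by
  rw [Matrix.trace_fin_two]; simp [hermMat]; ring

lemma hermMat_sq {k : Spacetime} (hk : k ∈ futureCone) :
    (hermMat k + (mass k : ℂ) • 1) * (hermMat k + (mass k : ℂ) • 1) =
      (2 * (mass k + k 0) : ℂ) • hermMat k := by
  have hm : (mass k : ℂ) ^ 2 = (k 0) ^ 2 - (k 1) ^ 2 - (k 2) ^ 2 - (k 3) ^ 2 := by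
    have : mass k ^ 2 = (k 0) ^ 2 - (k 1) ^ 2 - (k 2) ^ 2 - (k 3) ^ 2 := by
      rw [mass_sq hk, mink]; ring
    exact_mod_cast this
  have hI := Complex.I_sq
  ext i j
  fin_cases i <;> fin_cases j <;> simp [hermMat, Matrix.mul_apply, Fin.sum_univ_two]
  · linear_combination hm - (k 2 : ℂ) ^ 2 * hI
  · ring
  · ring
  · linear_combination hm - (k 2 : ℂ) ^ 2 * hI

lemma hermMat_eq_boost {k : Spacetime} (hk : k ∈ futureCone) :
    hermMat k = (mass k : ℂ) • (boost k * (boost k).conjTranspose) := by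
  have hm : (mass k : ℂ) ≠ 0 := by exact_mod_cast (mass_pos hk).ne'
  rw [boost_conjTranspose, boost, Matrix.smul_mul, Matrix.mul_smul, hermMat_sq hk, smul_smul,
    smul_smul, smul_smul]
  have h := boost_norm_sq hk
  have h2 := boost_scale_ne hk
  set c := (((Real.sqrt (2 * mass k * (mass k + k 0)) : ℝ) : ℂ))
  have hc : c ≠ 0 := by rintro h0; rw [h0] at h; apply h2; rw [← h]; ring
  have : (mass k : ℂ) * c⁻¹ * c⁻¹ * (2 * (mass k + k 0)) = 1 := by
    field_simp
    linear_combination -h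
  rw [this, one_smul]

lemma boost_det {k : Spacetime} (hk : k ∈ futureCone) : (boost k).det = 1 := by
  have h := boost_norm_sq hk
  have h2 := boost_scale_ne hk
  have hm : (mass k : ℂ) ^ 2 = (mink k k : ℝ) := by rw [← mass_sq hk]; push_cast; rfl
  have hd := hermMat_det k
  have ht := hermMat_trace k
  rw [Matrix.det_fin_two] at hd
  rw [Matrix.trace_fin_two] at ht
  rw [boost, Matrix.det_smul, Matrix.det_fin_two, Fintype.card_fin, inv_pow, h]
  have : (hermMat k + (mass k : ℂ) • 1) 0 0 * (hermMat k + (mass k : ℂ) • 1) 1 1 -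
      (hermMat k + (mass k : ℂ) • 1) 0 1 * (hermMat k + (mass k : ℂ) • 1) 1 0 =
      2 * mass k * (mass k + k 0) := by
    simp
    linear_combination hd + (mass k : ℂ) * ht - hm
  rw [this, inv_mul_cancel₀ h2]

lemma lorentz_boost {k : Spacetime} (hk : k ∈ futureCone) :
    lorentz (boost k) *ᵥ restMomentum (mass k) = k := by
  apply hermMat_injective
  rw [hermMat_lorentz, hermMat_restMomentum, Matrix.mul_smul, Matrix.mul_one, Matrix.smul_mul,
    ← hermMat_eq_boost hk]

lemma lorentz_mem_futureCone {a : Mat2} (ha : a.det = 1) {k : Spacetime} (hk : k ∈ futureCone) :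
    lorentz a *ᵥ k ∈ futureCone := by
  have hmk : 0 < mink (lorentz a *ᵥ k) (lorentz a *ᵥ k) := by rw [mink_lorentz ha]; exact hk.2
  refine ⟨?_, hmk⟩
  have ht := hermMat_trace (lorentz a *ᵥ k)
  rw [hermMat_lorentz, hermMat_eq_boost hk, Matrix.mul_smul, Matrix.smul_mul, ← Matrix.mul_assoc,
    Matrix.mul_assoc, ← Matrix.conjTranspose_mul, Matrix.trace_smul] at ht
  have htr : ∀ M : Mat2, 0 ≤ (M * M.conjTranspose).trace.re := by
    intro M
    have e : (M * M.conjTranspose).trace.re = Complex.normSq (M 0 0) + Complex.normSq (M 0 1) +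
        (Complex.normSq (M 1 0) + Complex.normSq (M 1 1)) := by
      rw [Matrix.trace_fin_two, Matrix.mul_apply, Matrix.mul_apply]
      simp only [Fin.sum_univ_two, Matrix.conjTranspose_apply, RCLike.star_def, Complex.mul_conj,
        Complex.add_re, Complex.ofReal_re]
    rw [e]
    have h := Complex.normSq_nonneg
    linarith [h (M 0 0), h (M 0 1), h (M 1 0), h (M 1 1)]
  have hre := congrArg Complex.re ht
  simp only [smul_eq_mul, Complex.re_ofReal_mul] at hre
  have h0 : 0 ≤ (lorentz a *ᵥ k) 0 := by
    have h1 := mul_nonneg (mass_pos hk).le (htr (a * boost k))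
    have h2 : (2 * (((lorentz a *ᵥ k) 0 : ℝ) : ℂ)).re = 2 * (lorentz a *ᵥ k) 0 := by simp
    rw [h2] at hre
    linarith
  rcases h0.lt_or_eq with h | h
  · exact h
  · exfalso
    simp only [mink, ← h] at hmk
    nlinarith [mul_self_nonneg ((lorentz a *ᵥ k) 1), mul_self_nonneg ((lorentz a *ᵥ k) 2),
      mul_self_nonneg ((lorentz a *ᵥ k) 3)]

/-- The space of the index `m`, for spin `j = n / 2`. -/
noncomputable abbrev SpinSpace (n : ℕ) := EuclideanSpace ℂ (Fin (n + 1))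

/-- The action of `R^j(u)` on a vector, `j = n / 2`. -/
noncomputable def spinAct (n : ℕ) (u : Mat2) (v : SpinSpace n) : SpinSpace n :=
  WithLp.toLp 2 (spinRep n u *ᵥ v.ofLp)

/-- The wave function `ψ_m(μ, a)` on `SL(2, ℂ)` that has the values `ψ_m(μ, a_k) = f_m(k)` and satisfies
the covariance condition `ψ(μ, a u) = R^j(u⁻¹) ψ(μ, a)` for `u` in `SU(2)`
(see `waveOnGroup_boost` and `waveOnGroup_covariant`). -/
noncomputable def waveOnGroup (n : ℕ) (f : Spacetime → SpinSpace n) (μ : ℝ) (a : Mat2) :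
    SpinSpace n :=
  let k := lorentz a *ᵥ restMomentum μ
  spinAct n (a⁻¹ * boost k) (f k)

/-- The action of the element `(x, b)` of the universal covering of the Poincaré group on wave
functions, `[U(x, b) ψ](μ, a) = exp(i k · x) ψ(μ, b⁻¹ a)` with `k = Λ(a) q(μ)`, written at `a = a_k`
(see `waveOnGroup_poincareAct` for general `a`). -/
noncomputable def poincareAct (n : ℕ) (x : Spacetime) (b : SL2C) (f : Spacetime → SpinSpace n)
    (k : Spacetime) : SpinSpace n :=
  Complex.exp (Complex.I * (mink k x : ℝ)) •
    waveOnGroup n f (mass k) ((b⁻¹ : SL2C) * boost k)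

lemma spinAct_mul (n : ℕ) (u v : Mat2) (w : SpinSpace n) :
    spinAct n (u * v) w = spinAct n u (spinAct n v w) := by
  simp [spinAct, spinRep_mul]

lemma spinAct_one (n : ℕ) (w : SpinSpace n) : spinAct n 1 w = w := by
  simp [spinAct, spinRep_one]

lemma spinAct_add (n : ℕ) (u : Mat2) (v w : SpinSpace n) :
    spinAct n u (v + w) = spinAct n u v + spinAct n u w := by
  simp [spinAct, Matrix.mulVec_add]

lemma spinAct_smul (n : ℕ) (u : Mat2) (c : ℂ) (v : SpinSpace n) :
    spinAct n u (c • v) = c • spinAct n u v := by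
  simp [spinAct, Matrix.mulVec_smul]

lemma norm_spinAct (n : ℕ) {u : Mat2} (hu : u.conjTranspose * u = 1) (v : SpinSpace n) :
    ‖spinAct n u v‖ = ‖v‖ := by
  have h : (‖spinAct n u v‖ ^ 2 : ℝ) = ‖v‖ ^ 2 := by
    have e : ∀ w : SpinSpace n, ((‖w‖ ^ 2 : ℝ) : ℂ) = star w.ofLp ⬝ᵥ w.ofLp := by
      intro w
      have := inner_self_eq_norm_sq_to_K (𝕜 := ℂ) w
      rw [EuclideanSpace.inner_eq_star_dotProduct, dotProduct_comm] at this
      rw [this]; push_cast; rfl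
    have : ((‖spinAct n u v‖ ^ 2 : ℝ) : ℂ) = ((‖v‖ ^ 2 : ℝ) : ℂ) := by
      rw [e, e, spinAct, Matrix.star_mulVec, Matrix.dotProduct_mulVec, Matrix.vecMul_vecMul,
        spinRep_unitary n hu, Matrix.vecMul_one]
    exact_mod_cast this
  exact (pow_left_inj₀ (norm_nonneg _) (norm_nonneg _) two_ne_zero).mp h

lemma waveOnGroup_boost (n : ℕ) (f : Spacetime → SpinSpace n) {k : Spacetime}
    (hk : k ∈ futureCone) : waveOnGroup n f (mass k) (boost k) = f k := by
  simp only [waveOnGroup, lorentz_boost hk]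
  rw [Matrix.nonsing_inv_mul _ (by rw [boost_det hk]; exact isUnit_one), spinAct_one]

lemma waveOnGroup_covariant (n : ℕ) (f : Spacetime → SpinSpace n) (μ : ℝ) (a : Mat2) {u : Mat2}
    (hu : u * u.conjTranspose = 1) :
    waveOnGroup n f μ (a * u) = spinAct n u⁻¹ (waveOnGroup n f μ a) := by
  have hq : lorentz (a * u) *ᵥ restMomentum μ = lorentz a *ᵥ restMomentum μ := by
    apply hermMat_injective
    rw [hermMat_lorentz, hermMat_lorentz, hermMat_restMomentum, Matrix.conjTranspose_mul]
    simp only [Matrix.mul_smul, Matrix.smul_mul, Matrix.mul_one]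
    rw [Matrix.mul_assoc, ← Matrix.mul_assoc u, hu, Matrix.one_mul]
  simp only [waveOnGroup, hq]
  rw [← spinAct_mul, Matrix.mul_inv_rev, Matrix.mul_assoc]

lemma det_coe_inv (b : SL2C) : ((b⁻¹ : SL2C) : Mat2).det = 1 := (b⁻¹).det_coe

lemma det_inv_boost (b : SL2C) {k : Spacetime} (hk : k ∈ futureCone) :
    (((b⁻¹ : SL2C) : Mat2) * boost k).det = 1 := by
  rw [Matrix.det_mul, det_coe_inv, boost_det hk, one_mul]

lemma lorentz_restMomentum_mem {a : Mat2} (ha : a.det = 1) {μ : ℝ} (hμ : 0 < μ) :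
    lorentz a *ᵥ restMomentum μ ∈ futureCone ∧ mass (lorentz a *ᵥ restMomentum μ) = μ := by
  have hm : mink (restMomentum μ) (restMomentum μ) = μ ^ 2 := by
    simp [mink, restMomentum]; ring
  have h : restMomentum μ ∈ futureCone := by
    refine ⟨by simpa [restMomentum] using hμ, ?_⟩
    rw [hm]; positivity
  refine ⟨lorentz_mem_futureCone ha h, ?_⟩
  rw [mass_lorentz ha, mass, hm, Real.sqrt_sq hμ.le]

lemma rotation_unitary {a : Mat2} (ha : a.det = 1) {μ : ℝ} (hμ : 0 < μ) :
    (a⁻¹ * boost (lorentz a *ᵥ restMomentum μ)) *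
      (a⁻¹ * boost (lorentz a *ᵥ restMomentum μ)).conjTranspose = 1 := by
  obtain ⟨hk, hmk⟩ := lorentz_restMomentum_mem ha hμ
  have h1 := hermMat_eq_boost hk
  rw [hmk, hermMat_lorentz, hermMat_restMomentum, Matrix.mul_smul, Matrix.mul_one,
    Matrix.smul_mul] at h1
  have h2 := smul_right_injective Mat2 (show (μ : ℂ) ≠ 0 by exact_mod_cast hμ.ne') h1
  have hu : IsUnit a.det := by rw [ha]; exact isUnit_one
  have hu' : IsUnit a.conjTranspose.det := by
    rw [Matrix.det_conjTranspose, ha]; simp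
  rw [Matrix.conjTranspose_mul, Matrix.mul_assoc, ← Matrix.mul_assoc (boost _), ← h2,
    Matrix.conjTranspose_nonsing_inv, Matrix.mul_assoc, Matrix.mul_nonsing_inv _ hu',
    Matrix.mul_one, Matrix.nonsing_inv_mul _ hu]

lemma waveOnGroup_poincareAct (n : ℕ) (x : Spacetime) (b : SL2C) (f : Spacetime → SpinSpace n)
    {μ : ℝ} (hμ : 0 < μ) {a : Mat2} (ha : a.det = 1) :
    waveOnGroup n (poincareAct n x b f) μ a =
      Complex.exp (Complex.I * (mink (lorentz a *ᵥ restMomentum μ) x : ℝ)) •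
        waveOnGroup n f μ (((b⁻¹ : SL2C) : Mat2) * a) := by
  obtain ⟨-, hmk⟩ := lorentz_restMomentum_mem ha hμ
  have hu := rotation_unitary ha hμ
  conv_lhs => simp only [waveOnGroup.eq_1 n (poincareAct n x b f)]
  simp only [poincareAct, hmk]
  set u := a⁻¹ * boost (lorentz a *ᵥ restMomentum μ) with hudef
  have ha' : IsUnit a.det := by rw [ha]; exact isUnit_one
  have hb : boost (lorentz a *ᵥ restMomentum μ) = a * u := by
    rw [hudef, ← Matrix.mul_assoc, Matrix.mul_nonsing_inv _ ha', Matrix.one_mul]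
  rw [hb, ← Matrix.mul_assoc, waveOnGroup_covariant n f μ _ hu, spinAct_smul, ← spinAct_mul,
    Matrix.mul_nonsing_inv, spinAct_one]
  exact (Matrix.isUnit_iff_isUnit_det _).mp (IsUnit.of_mul_eq_one _ hu)

lemma mink_add_right (k x y : Spacetime) : mink k (x + y) = mink k x + mink k y := by
  simp [mink]; ring

/-- The Wigner rotation occurring in `poincareAct`. -/
noncomputable def wignerRotation (b : SL2C) (k : Spacetime) : Mat2 :=
  (((b⁻¹ : SL2C) : Mat2) * boost k).adjugate * boost (lorentz ((b⁻¹ : SL2C) : Mat2) *ᵥ k)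

lemma lorentz_inv_boost (b : SL2C) {k : Spacetime} (hk : k ∈ futureCone) :
    lorentz (((b⁻¹ : SL2C) : Mat2) * boost k) *ᵥ restMomentum (mass k) =
      lorentz ((b⁻¹ : SL2C) : Mat2) *ᵥ k := by
  rw [lorentz_mul, ← Matrix.mulVec_mulVec, lorentz_boost hk]

lemma wignerRotation_eq (b : SL2C) {k : Spacetime} (hk : k ∈ futureCone) :
    (((b⁻¹ : SL2C) : Mat2) * boost k)⁻¹ * boost (lorentz ((b⁻¹ : SL2C) : Mat2) *ᵥ k) =
      wignerRotation b k := by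
  rw [wignerRotation, Matrix.inv_def, det_inv_boost b hk, Ring.inverse_one, one_smul]

lemma poincareAct_eq (n : ℕ) (x : Spacetime) (b : SL2C) (f : Spacetime → SpinSpace n)
    {k : Spacetime} (hk : k ∈ futureCone) :
    poincareAct n x b f k = Complex.exp (Complex.I * (mink k x : ℝ)) •
      spinAct n (wignerRotation b k) (f (lorentz ((b⁻¹ : SL2C) : Mat2) *ᵥ k)) := by
  simp only [poincareAct, waveOnGroup]
  rw [lorentz_inv_boost b hk, wignerRotation_eq b hk]

lemma norm_poincareAct (n : ℕ) (x : Spacetime) (b : SL2C) (f : Spacetime → SpinSpace n)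
    {k : Spacetime} (hk : k ∈ futureCone) :
    ‖poincareAct n x b f k‖ = ‖f (lorentz ((b⁻¹ : SL2C) : Mat2) *ᵥ k)‖ := by
  have hu := rotation_unitary (det_inv_boost b hk) (mass_pos hk)
  rw [lorentz_inv_boost b hk, wignerRotation_eq b hk] at hu
  rw [poincareAct_eq n x b f hk, norm_smul, norm_spinAct n (mul_eq_one_comm.mp hu), mul_comm,
    mul_comm Complex.I, Complex.norm_exp_ofReal_mul_I, mul_one]

lemma continuous_linear_pow_coeff (i : Fin 2) (p q : ℕ) : Continuous fun u : Mat2 =>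
    ((Polynomial.C (u 0 i) * Polynomial.X + Polynomial.C (u 1 i)) ^ p).coeff q := by
  induction p generalizing q with
  | zero => simp only [pow_zero]; exact continuous_const
  | succ p ih =>
    simp only [pow_succ, mul_add, Polynomial.coeff_add, ← mul_assoc, Polynomial.coeff_mul_C]
    refine Continuous.add ?_ ((ih q).mul (by fun_prop))
    cases q with
    | zero => simp only [Polynomial.coeff_mul_X_zero]; exact continuous_const
    | succ q =>
      simp only [Polynomial.coeff_mul_X, Polynomial.coeff_mul_C]
      exact (ih q).mul (by fun_prop)

lemma continuous_spinRep (n : ℕ) : Continuous (spinRep n) := by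
  refine continuous_matrix fun q p => ?_
  simp only [spinRep, Matrix.of_apply, Polynomial.coeff_mul]
  refine continuous_const.mul (continuous_finsetSum _ fun c _ => ?_)
  exact (continuous_linear_pow_coeff 0 _ _).mul (continuous_linear_pow_coeff 1 _ _)

lemma continuous_spinAct (n : ℕ) :
    Continuous fun p : Mat2 × SpinSpace n => spinAct n p.1 p.2 := by
  refine (PiLp.continuous_toLp 2 _).comp ?_
  exact ((continuous_spinRep n).comp continuous_fst).matrix_mulVec
    ((PiLp.continuous_ofLp 2 _).comp continuous_snd)

lemma continuous_hermMat : Continuous hermMat := by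
  refine continuous_matrix fun i j => ?_
  fin_cases i <;> fin_cases j <;> simp [hermMat] <;> fun_prop

lemma continuous_mass : Continuous mass := by
  unfold mass mink; fun_prop

lemma pseudoMetrizable_mat2 : TopologicalSpace.PseudoMetrizableSpace Mat2 :=
  inferInstanceAs (TopologicalSpace.PseudoMetrizableSpace (Fin 2 → Fin 2 → ℂ))

lemma stronglyMeasurable_boost : MeasureTheory.StronglyMeasurable boost := by
  have := pseudoMetrizable_mat2
  have h0 := continuous_mass
  have h1 : Measurable fun k : Spacetime =>
      ((Real.sqrt (2 * mass k * (mass k + k 0)) : ℝ) : ℂ)⁻¹ := by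
    have : Continuous fun k : Spacetime => ((Real.sqrt (2 * mass k * (mass k + k 0)) : ℝ) : ℂ) := by
      fun_prop
    exact this.measurable.inv
  have h2 : Continuous fun k : Spacetime => hermMat k + (mass k : ℂ) • (1 : Mat2) := by
    have := continuous_hermMat
    fun_prop
  exact h1.stronglyMeasurable.smul h2.stronglyMeasurable

lemma stronglyMeasurable_wignerRotation (b : SL2C) :
    MeasureTheory.StronglyMeasurable (wignerRotation b) := by
  have h1 : Continuous fun A : Mat2 => (((b⁻¹ : SL2C) : Mat2) * A).adjugate := by fun_prop
  have h2 : Continuous fun k : Spacetime => lorentz ((b⁻¹ : SL2C) : Mat2) *ᵥ k := by fun_prop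
  have hm : Continuous fun p : Mat2 × Mat2 => p.1 * p.2 := by fun_prop
  exact hm.comp_stronglyMeasurable ((h1.comp_stronglyMeasurable stronglyMeasurable_boost).prodMk
    (stronglyMeasurable_boost.comp_measurable h2.measurable))

open MeasureTheory

variable {S : Type*}

/-- The four-momenta in the open future cone whose mass lies in the mass spectrum `Δ σ n`
of the component with labels `i = (σ, n)`, `n = 2 j`. -/
def spectralRegion (Δ : S → ℕ → Set ℝ) (i : S × ℕ) : Set Spacetime :=
  {k | k ∈ futureCone ∧ mass k ∈ Δ i.1 i.2}

/-- Lebesgue measure `d⁴k` on that region. -/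
noncomputable def spectralMeasure (Δ : S → ℕ → Set ℝ) (i : S × ℕ) : Measure Spacetime :=
  volume.restrict (spectralRegion Δ i)

lemma measurableSet_futureCone : MeasurableSet futureCone := by
  have h : Continuous fun k : Spacetime => mink k k := by unfold mink; fun_prop
  exact ((isOpen_lt continuous_const (continuous_apply 0)).inter
    (isOpen_lt continuous_const h)).measurableSet

lemma ae_mem_futureCone (Δ : S → ℕ → Set ℝ) (i : S × ℕ) :
    ∀ᵐ k ∂(spectralMeasure Δ i), k ∈ futureCone := by
  exact ae_restrict_of_ae_restrict_of_subset (fun k hk => hk.1)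
    (ae_restrict_mem measurableSet_futureCone)

lemma lorentz_inv_mulVec (b : SL2C) (k : Spacetime) :
    lorentz ((b⁻¹ : SL2C) : Mat2) *ᵥ (lorentz (b : Mat2) *ᵥ k) = k := by
  rw [Matrix.mulVec_mulVec, ← lorentz_mul, ← Matrix.SpecialLinearGroup.coe_mul, inv_mul_cancel,
    Matrix.SpecialLinearGroup.coe_one, lorentz_one, Matrix.one_mulVec]

/-- The Lorentz transformation as an invertible measurable map. -/
noncomputable def lorentzEquiv (b : SL2C) : Spacetime ≃ᵐ Spacetime where
  toFun k := lorentz (b : Mat2) *ᵥ k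
  invFun k := lorentz ((b⁻¹ : SL2C) : Mat2) *ᵥ k
  left_inv k := lorentz_inv_mulVec b k
  right_inv k := by simpa using lorentz_inv_mulVec b⁻¹ k
  measurable_toFun := by
    have : Continuous fun k : Spacetime => lorentz (b : Mat2) *ᵥ k := by fun_prop
    exact this.measurable
  measurable_invFun := by
    have : Continuous fun k : Spacetime => lorentz ((b⁻¹ : SL2C) : Mat2) *ᵥ k := by fun_prop
    exact this.measurable

lemma measurePreserving_lorentz (Δ : S → ℕ → Set ℝ) (i : S × ℕ) (b : SL2C) :
    MeasurePreserving (fun k => lorentz (b : Mat2) *ᵥ k)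
      (spectralMeasure Δ i) (spectralMeasure Δ i) := by
  have habs := abs_det_lorentz b.det_coe
  have hdet : (lorentz (b : Mat2)).det ≠ 0 := by
    intro h; rw [h] at habs; simp at habs
  have hvol : MeasurePreserving (lorentzEquiv b) volume volume := by
    refine ⟨(lorentzEquiv b).measurable, ?_⟩
    have h := Real.map_matrix_volume_pi_eq_smul_volume_pi hdet
    rw [abs_inv, habs, inv_one, ENNReal.ofReal_one, one_smul] at h
    exact h
  have h := hvol.restrict_preimage_emb (lorentzEquiv b).measurableEmbedding (spectralRegion Δ i)
  have hpre : (lorentzEquiv b) ⁻¹' (spectralRegion Δ i) = spectralRegion Δ i := by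
    ext k
    change lorentz (b : Mat2) *ᵥ k ∈ futureCone ∧ mass (lorentz (b : Mat2) *ᵥ k) ∈ _ ↔
      k ∈ futureCone ∧ mass k ∈ _
    rw [mass_lorentz b.det_coe]
    refine and_congr_left fun _ => ⟨fun h => ?_, lorentz_mem_futureCone b.det_coe⟩
    have := lorentz_mem_futureCone (det_coe_inv b) h
    rwa [lorentz_inv_mulVec] at this
  rw [hpre] at h
  exact h

/-- The component of the state space with labels `i = (σ, n)`: square-integrable wave functions
`k ↦ (ψ_{σ j m}(μ, a_k))_m` of the four-momentum in the open future cone, with mass spectrum `Δ σ n`. -/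
abbrev WaveSpace (Δ : S → ℕ → Set ℝ) (i : S × ℕ) : Type :=
  Lp (SpinSpace i.2) 2 (spectralMeasure Δ i)

/-- The Hilbert space `𝓗`, the Hilbert sum over `(σ, n)`, `n = 2 j = 0, 1, 2, …`, with
`‖ψ‖² = ∫_V ∑_{σ j m} |ψ_{σ j m}(μ, a_k)|² d⁴k`. -/
abbrev StateSpace (Δ : S → ℕ → Set ℝ) : Type _ := lp (fun i : S × ℕ => WaveSpace Δ i) 2

lemma poincareAct_congr (Δ : S → ℕ → Set ℝ) (i : S × ℕ) (x : Spacetime) (b : SL2C)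
    {f g : Spacetime → SpinSpace i.2} (h : f =ᵐ[spectralMeasure Δ i] g) :
    poincareAct i.2 x b f =ᵐ[spectralMeasure Δ i] poincareAct i.2 x b g := by
  filter_upwards [ae_mem_futureCone Δ i,
    (measurePreserving_lorentz Δ i b⁻¹).quasiMeasurePreserving.ae h] with k hk hfg
  rw [poincareAct_eq _ _ _ _ hk, poincareAct_eq _ _ _ _ hk, hfg]

lemma eLpNorm_poincareAct (Δ : S → ℕ → Set ℝ) (i : S × ℕ) (x : Spacetime) (b : SL2C)
    {f : Spacetime → SpinSpace i.2} (hf : AEStronglyMeasurable f (spectralMeasure Δ i)) :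
    eLpNorm (poincareAct i.2 x b f) 2 (spectralMeasure Δ i) =
      eLpNorm f 2 (spectralMeasure Δ i) := by
  rw [← eLpNorm_comp_measurePreserving hf (measurePreserving_lorentz Δ i b⁻¹)]
  refine eLpNorm_congr_norm_ae ?_
  filter_upwards [ae_mem_futureCone Δ i] with k hk
  exact norm_poincareAct _ _ _ _ hk

lemma memLp_poincareAct (Δ : S → ℕ → Set ℝ) (i : S × ℕ) (x : Spacetime) (b : SL2C)
    {f : Spacetime → SpinSpace i.2} (hf : MemLp f 2 (spectralMeasure Δ i)) :
    MemLp (poincareAct i.2 x b f) 2 (spectralMeasure Δ i) := by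
  refine ⟨?_, by rw [eLpNorm_poincareAct Δ i x b hf.1]; exact hf.2⟩
  have h1 : Continuous fun k : Spacetime => Complex.exp (Complex.I * (mink k x : ℝ)) := by
    unfold mink; fun_prop
  have h2 := hf.1.comp_measurePreserving (measurePreserving_lorentz Δ i b⁻¹)
  have h3 := (continuous_spinAct i.2).comp_aestronglyMeasurable
    ((stronglyMeasurable_wignerRotation b).aestronglyMeasurable.prodMk h2)
  refine (h1.aestronglyMeasurable.smul h3).congr ?_
  filter_upwards [ae_mem_futureCone Δ i] with k hk
  exact (poincareAct_eq _ _ _ _ hk).symm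

/-- `U(x, b)` on one component. -/
noncomputable def waveTransform (Δ : S → ℕ → Set ℝ) (i : S × ℕ) (x : Spacetime) (b : SL2C) :
    WaveSpace Δ i →ₗᵢ[ℂ] WaveSpace Δ i where
  toFun f := (memLp_poincareAct Δ i x b (Lp.memLp f)).toLp _
  map_add' f g := by
    rw [← MemLp.toLp_add, MemLp.toLp_eq_toLp_iff]
    refine (poincareAct_congr Δ i x b (Lp.coeFn_add f g)).trans (Filter.Eventually.of_forall ?_)
    intro k
    simp only [poincareAct, waveOnGroup, Pi.add_apply, spinAct_add, smul_add]
  map_smul' c f := by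
    rw [RingHom.id_apply, ← MemLp.toLp_const_smul, MemLp.toLp_eq_toLp_iff]
    refine (poincareAct_congr Δ i x b (Lp.coeFn_smul c f)).trans (Filter.Eventually.of_forall ?_)
    intro k
    simp only [poincareAct, waveOnGroup, Pi.smul_apply, spinAct_smul, smul_comm c]
  norm_map' f := by
    change ‖(memLp_poincareAct Δ i x b (Lp.memLp f)).toLp _‖ = ‖f‖
    rw [Lp.norm_toLp, Lp.norm_def, eLpNorm_poincareAct Δ i x b (Lp.memLp f).1]

/-- The representation `U(x, b)` on the state space. It is isometric by construction, and it is a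
unitary representation by `poincareU_mul`, `poincareU_one` and `poincareU_surjective`. -/
noncomputable def poincareU (Δ : S → ℕ → Set ℝ) (x : Spacetime) (b : SL2C) :
    StateSpace Δ →ₗᵢ[ℂ] StateSpace Δ where
  toFun ψ := ⟨fun i => waveTransform Δ i x b (ψ i), by
    have h := lp.memℓp ψ
    rw [memℓp_gen_iff (by norm_num)] at h
    refine memℓp_gen ?_
    simpa only [LinearIsometry.norm_map] using h⟩
  map_add' ψ φ := by ext1; funext i; exact map_add (waveTransform Δ i x b) (ψ i) (φ i)
  map_smul' c ψ := by ext1; funext i; exact map_smul (waveTransform Δ i x b) c (ψ i)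
  norm_map' ψ := by
    rw [lp.norm_eq_tsum_rpow (by norm_num), lp.norm_eq_tsum_rpow (by norm_num)]
    simp only [LinearMap.coe_mk, AddHom.coe_mk, LinearIsometry.norm_map]

lemma poincareAct_mul (n : ℕ) (x y : Spacetime) (b c : SL2C) (f : Spacetime → SpinSpace n)
    {k : Spacetime} (hk : k ∈ futureCone) :
    poincareAct n x b (poincareAct n y c f) k =
      poincareAct n (x + lorentz (b : Mat2) *ᵥ y) (b * c) f k := by
  conv_lhs => rw [poincareAct.eq_1 n x b]
  rw [waveOnGroup_poincareAct n y c f (mass_pos hk) (det_inv_boost b hk), lorentz_inv_boost b hk,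
    smul_smul, ← Complex.exp_add, poincareAct, mul_inv_rev, Matrix.SpecialLinearGroup.coe_mul,
    Matrix.mul_assoc, mink_add_right, Complex.ofReal_add, mul_add]
  have h := mink_lorentz_lorentz (det_coe_inv b) k (lorentz (b : Mat2) *ᵥ y)
  rw [lorentz_inv_mulVec] at h
  rw [h]

lemma coeFn_poincareU (Δ : S → ℕ → Set ℝ) (x : Spacetime) (b : SL2C) (ψ : StateSpace Δ)
    (i : S × ℕ) :
    poincareU Δ x b ψ i =ᵐ[spectralMeasure Δ i] poincareAct i.2 x b (ψ i) :=
  MemLp.coeFn_toLp (memLp_poincareAct Δ i x b (Lp.memLp (ψ i)))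

lemma poincareU_mul (Δ : S → ℕ → Set ℝ) (x y : Spacetime) (b c : SL2C) (ψ : StateSpace Δ) :
    poincareU Δ x b (poincareU Δ y c ψ) =
      poincareU Δ (x + lorentz (b : Mat2) *ᵥ y) (b * c) ψ := by
  ext1; funext i
  refine Lp.ext ?_
  refine (coeFn_poincareU Δ x b _ i).trans
    ((poincareAct_congr Δ i x b (coeFn_poincareU Δ y c ψ i)).trans
      (Filter.EventuallyEq.trans ?_ (coeFn_poincareU Δ _ _ ψ i).symm))
  filter_upwards [ae_mem_futureCone Δ i] with k hk
  exact poincareAct_mul _ _ _ _ _ _ hk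

lemma poincareU_one (Δ : S → ℕ → Set ℝ) (ψ : StateSpace Δ) : poincareU Δ 0 1 ψ = ψ := by
  ext1; funext i
  refine Lp.ext ((coeFn_poincareU Δ 0 1 ψ i).trans ?_)
  filter_upwards [ae_mem_futureCone Δ i] with k hk
  have h0 : mink k 0 = 0 := by simp [mink]
  rw [poincareAct, h0, inv_one, Matrix.SpecialLinearGroup.coe_one, Matrix.one_mul,
    waveOnGroup_boost _ _ hk]
  simp

lemma poincareU_surjective (Δ : S → ℕ → Set ℝ) (x : Spacetime) (b : SL2C) :
    Function.Surjective (poincareU Δ x b) := by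
  intro ψ
  refine ⟨poincareU Δ (-(lorentz ((b⁻¹ : SL2C) : Mat2) *ᵥ x)) b⁻¹ ψ, ?_⟩
  have h : lorentz (b : Mat2) *ᵥ (lorentz ((b⁻¹ : SL2C) : Mat2) *ᵥ x) = x := by
    simpa using lorentz_inv_mulVec b⁻¹ x
  rw [poincareU_mul, Matrix.mulVec_neg, h, add_neg_cancel, mul_inv_cancel, poincareU_one]

/-- A normalized positive-operator-valued measure on the Borel sets of space-time
(the value at a non-measurable set plays no role). -/
structure POVMeasure (H : Type*) [NormedAddCommGroup H] [InnerProductSpace ℂ H] where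
  effect : Set Spacetime → (H →L[ℂ] H)
  isPositive : ∀ I, MeasurableSet I → (effect I).IsPositive
  hasSum_iUnion : ∀ I : ℕ → Set Spacetime, (∀ m, MeasurableSet (I m)) →
    Pairwise (fun m m' => Disjoint (I m) (I m')) → ∀ ψ φ : H,
    HasSum (fun m => inner ℂ ψ (effect (I m) φ)) (inner ℂ ψ (effect (⋃ m, I m) φ))
  effect_univ : effect Set.univ = 1

/-- Poincaré covariance: `U(x, b)† τ(Λ(b) I + x) U(x, b) = τ(I)`. -/
def IsPoincareCovariant {Δ : S → ℕ → Set ℝ} (τ : POVMeasure (StateSpace Δ)) : Prop :=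
  ∀ (x : Spacetime) (b : SL2C) (I : Set Spacetime), MeasurableSet I →
    (poincareU Δ x b).toContinuousLinearMap.adjoint ∘L
      τ.effect ((fun y => lorentz (b : Mat2) *ᵥ y + x) '' I) ∘L
        (poincareU Δ x b).toContinuousLinearMap = τ.effect I

/-- A family of wave functions `f_{σ j m}(k)` that are `C^∞` with compact support in the open future
cone, vanish for all but finitely many labels, and vanish off the mass spectrum. -/
structure IsTestFamily (Δ : S → ℕ → Set ℝ) (f : (i : S × ℕ) → Spacetime → SpinSpace i.2) :
    Prop where
  smooth : ∀ i, ContDiff ℝ ∞ (f i)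
  compact : ∀ i, HasCompactSupport (f i)
  supp : ∀ i, tsupport (f i) ⊆ futureCone
  finite : {i | f i ≠ 0}.Finite
  spectrum : ∀ i, ∀ᵐ k, k ∉ spectralRegion Δ i → f i k = 0

/-- The space `𝓓` of the state vectors given by such wave functions. -/
def testDomain (Δ : S → ℕ → Set ℝ) : Submodule ℂ (StateSpace Δ) where
  carrier := {ψ | ∃ f, IsTestFamily Δ f ∧ ∀ i, ψ i =ᵐ[spectralMeasure Δ i] f i}
  zero_mem' := by
    refine ⟨fun _ => 0, ⟨fun _ => contDiff_const, fun _ => HasCompactSupport.zero,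
      fun i => ?_, by simp, fun i => by simp⟩, fun i => Lp.coeFn_zero _ _ _⟩
    rw [tsupport_eq_empty_iff.mpr rfl]; exact Set.empty_subset _
  add_mem' := by
    rintro ψ φ ⟨f, hf, hψ⟩ ⟨g, hg, hφ⟩
    refine ⟨fun i => f i + g i, ⟨fun i => (hf.smooth i).add (hg.smooth i),
      fun i => (hf.compact i).add (hg.compact i),
      fun i => (tsupport_add (f i) (g i)).trans (Set.union_subset (hf.supp i) (hg.supp i)), ?_,
      fun i => ?_⟩, fun i => ?_⟩
    · refine (hf.finite.union hg.finite).subset fun i hi => ?_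
      by_contra hn
      simp only [Set.mem_union, Set.mem_ofPred_eq, not_or, not_not] at hn
      exact hi (by rw [hn.1, hn.2, add_zero])
    · filter_upwards [hf.spectrum i, hg.spectrum i] with k h1 h2 hk
      rw [Pi.add_apply, h1 hk, h2 hk, add_zero]
    · exact (Lp.coeFn_add (ψ i) (φ i)).trans ((hψ i).add (hφ i))
  smul_mem' := by
    rintro c ψ ⟨f, hf, hψ⟩
    refine ⟨fun i => c • f i, ⟨fun i => contDiff_const.smul (hf.smooth i),
      fun i => (hf.compact i).smul_left (f := fun _ => c),
      fun i => (tsupport_smul_subset_right (fun _ => c) (f i)).trans (hf.supp i), ?_,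
      fun i => ?_⟩, fun i => ?_⟩
    · refine hf.finite.subset fun i hi h0 => hi (by rw [h0, smul_zero])
    · filter_upwards [hf.spectrum i] with k h1 hk
      rw [Pi.smul_apply, h1 hk, smul_zero]
    · exact (Lp.coeFn_smul c (ψ i)).trans ((hψ i).const_smul c)

end QEvent

/-! Covariance under translations means that the Fourier transform of `τ` shifts momenta. A vector
with bounded momenta should therefore give a measure `I ↦ (ψ, τ(I) ψ)` whose Fourier transform
vanishes outside a bounded set, and such a measure has a smooth density.

The shift is never expressed through operator-valued Fourier transforms. Fix a frequency `ξ` and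
consider the form `B(ψ) = ∫ exp(-2πi ⟪y, ξ⟫) d(ψ, τ(y) ψ)`. Translation by half a period along `ξ`
reverses the sign of `B`. For large `ξ` this translation is short, so on vectors with momentum in a
fixed ball it moves each vector by at most `ε < 1` times its length. A bounded form that changes
sign under an almost trivial isometry must vanish: any bound `|B(ψ)| ≤ M ‖ψ‖²` on that subspace
improves to `ε M`, and iteration gives zero. This is `POVMeasure.integral_diagMeasure_eq_zero`,
applied in `IsPoincareCovariant.integral_phase_eq_zero`.

By `exists_smooth_density_of_measureFourier`, a finite measure with compactly supported Fourier
transform has as density the real part of the inverse transform, which is smooth, and which is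
integrable because the measure is finite. Polarization extends this to pairs `ψ, φ`. On the
diagonal, continuity turns positivity of the integrals over balls into pointwise positivity. -/

namespace QEvent

/-! ### Fourier inversion for finite measures -/

section FourierInversion

open MeasureTheory Filter
open scoped FourierTransform RealInnerProductSpace SchwartzMap Topology

variable {V : Type*} [NormedAddCommGroup V] [InnerProductSpace ℝ V] [MeasurableSpace V]

/-- The Fourier transform `ξ ↦ ∫ exp(-2πi ⟪x, ξ⟫) dμ(x)` of a measure. -/
noncomputable def measureFourier (μ : Measure V) (ξ : V) : ℂ :=
  VectorFourier.fourierIntegral 𝐞 μ (innerₗ V) (fun _ => (1 : ℂ)) ξ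

lemma measureFourier_eq (μ : Measure V) (ξ : V) :
    measureFourier μ ξ = ∫ x, (𝐞 (-⟪x, ξ⟫) : ℂ) ∂μ := by
  simp [measureFourier, VectorFourier.fourierIntegral, Circle.smul_def]

variable [BorelSpace V]

lemma continuous_measureFourier (μ : Measure V) [IsFiniteMeasure μ] :
    Continuous (measureFourier μ) :=
  VectorFourier.fourierIntegral_continuous Real.continuous_fourierChar continuous_inner
    (integrable_const 1)

variable [FiniteDimensional ℝ V]

/-- Compact support makes every moment `‖v‖ ^ n * ‖f v‖` integrable, so one may differentiate under
the integral sign any number of times. -/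
lemma contDiff_fourierInv_of_hasCompactSupport {f : V → ℂ} (hf : Continuous f)
    (hs : HasCompactSupport f) : ContDiff ℝ ∞ (𝓕⁻ f) := by
  have h : 𝓕⁻ f = fun x => 𝓕 f (-x) := funext fun x => Real.fourierInv_eq_fourier_neg f x
  rw [h]
  refine (Real.contDiff_fourier (N := ⊤) fun n _ => ?_).comp contDiff_neg
  exact ((continuous_norm.pow n).mul hf.norm).integrable_of_hasCompactSupport hs.norm.mul_left

/-- Fourier inversion for a finite measure with integrable Fourier transform, tested against
Schwartz functions. -/
lemma integral_schwartz_eq_integral_fourierInv (μ : Measure V) [IsFiniteMeasure μ]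
    (hF : Integrable (measureFourier μ)) (g : 𝓢(V, ℂ)) :
    ∫ x, g x ∂μ = ∫ x, 𝓕⁻ (measureFourier μ) x * g x := by
  have hinv : 𝓕 (𝓕⁻ g) = g := FourierTransform.fourier_fourierInv_eq g
  -- The Fourier transform is moved from `μ` onto `𝓕⁻ g`, where it restores `g`.
  have h1 := VectorFourier.integral_fourierIntegral_smul_eq_flip (μ := μ) (ν := volume)
    (L := innerₗ V) (f := fun _ => (1 : ℂ)) (g := (𝓕⁻ g : 𝓢(V, ℂ)))
    Real.continuous_fourierChar continuous_inner (integrable_const 1) (𝓕⁻ g).integrable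
  -- With the sign of the pairing reversed, the same identity moves the inverse transform from
  -- `measureFourier μ` onto `g`. Both identities contain the integral of `measureFourier μ` times
  -- `𝓕⁻ g`.
  have h2 := VectorFourier.integral_fourierIntegral_smul_eq_flip (μ := volume) (ν := volume)
    (L := -innerₗ V) (f := measureFourier μ) (g := g)
    Real.continuous_fourierChar (by simpa using! continuous_inner.neg) hF g.integrable
  have e1 : ∀ x, VectorFourier.fourierIntegral 𝐞 volume (innerₗ V).flip
      (𝓕⁻ g : 𝓢(V, ℂ)) x = g x := by
    intro x
    conv_rhs => rw [← hinv]
    rw [SchwartzMap.fourier_coe, flip_innerₗ]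
    rfl
  have e2 : ∀ x, VectorFourier.fourierIntegral 𝐞 volume (-innerₗ V).flip g x =
      (𝓕⁻ g : 𝓢(V, ℂ)) x := by
    intro x
    have : (-innerₗ V).flip = -innerₗ V := by
      ext x y; simp [real_inner_comm]
    rw [SchwartzMap.fourierInv_coe, this]
    rfl
  simp only [e1, one_smul] at h1
  simp only [e2, smul_eq_mul] at h2
  simp only [smul_eq_mul] at h1
  rw [← h1]
  exact h2.symm

/-- `Real.smoothTransition` is `0` on `(-∞, 0]` and `1` on `[1, ∞)`, so the sequence vanishes where
`f x = 0` and equals `1` as soon as `n ≥ 1 / f x` elsewhere. -/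
lemma smoothTransition_tendsto_indicator {X : Type*} (f : X → ℝ) (hf : ∀ x, 0 ≤ f x) (x : X) :
    Tendsto (fun n : ℕ => ((Real.smoothTransition (n * f x) : ℝ) : ℂ)) atTop
      (𝓝 ((Function.support f).indicator (fun _ => (1 : ℂ)) x)) := by
  by_cases hx : f x = 0
  · simp [hx, Real.smoothTransition.zero_of_nonpos]
  · have hpos : 0 < f x := (hf x).lt_of_ne' hx
    rw [Set.indicator_of_mem hx]
    refine tendsto_const_nhds.congr' ?_
    obtain ⟨N, hN⟩ := exists_nat_ge (1 / f x)
    filter_upwards [eventually_ge_atTop N] with n hn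
    rw [Real.smoothTransition.one_of_one_le, Complex.ofReal_one]
    have : 1 / f x ≤ n := hN.trans (by exact_mod_cast hn)
    rwa [div_le_iff₀ hpos] at this

/-- The indicator of an open set is a pointwise limit of smooth functions with values in `[0, 1]`
that vanish off the set. Boundedness of `U` makes them compactly supported, and lets `‖ρ‖` on the
compact closure serve as dominating function although `ρ` is only assumed continuous. -/
lemma measureReal_eq_setIntegral_of_isOpen (μ : Measure V) [IsFiniteMeasure μ] {ρ : V → ℂ}
    (hρ : Continuous ρ) (h : ∀ g : 𝓢(V, ℂ), ∫ x, g x ∂μ = ∫ x, ρ x * g x) {U : Set V}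
    (hU : IsOpen U) (hb : Bornology.IsBounded U) : (μ.real U : ℂ) = ∫ x in U, ρ x := by
  obtain ⟨f, hfs, hfd, hfr⟩ := hU.exists_contDiff_support_eq (n := ⊤)
  have hf0 : ∀ x, 0 ≤ f x := fun x => (hfr ⟨x, rfl⟩).1
  have hcl : IsCompact (closure U) := hb.isCompact_closure
  set G : ℕ → V → ℂ := fun n x => ((Real.smoothTransition (n * f x) : ℝ) : ℂ) with hG
  have hGd : ∀ n, ContDiff ℝ ∞ (G n) := fun n =>
    Complex.ofRealCLM.contDiff.comp (Real.smoothTransition.contDiff.comp (contDiff_const.mul hfd))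
  have hG0 : ∀ n x, x ∉ U → G n x = 0 := by
    intro n x hx
    have : f x = 0 := by rw [← hfs] at hx; simpa using hx
    simp [hG, this, Real.smoothTransition.zero_of_nonpos]
  have hGc : ∀ n, HasCompactSupport (G n) := fun n =>
    HasCompactSupport.intro hcl fun x hx => hG0 n x fun hx' => hx (subset_closure hx')
  have hG1 : ∀ n x, ‖G n x‖ ≤ 1 := by
    intro n x
    rw [Complex.norm_real, Real.norm_of_nonneg (Real.smoothTransition.nonneg _)]
    exact Real.smoothTransition.le_one _
  have hlim : ∀ x, Tendsto (fun n => G n x) atTop (𝓝 (U.indicator (fun _ => (1 : ℂ)) x)) := by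
    intro x; rw [← hfs]; exact smoothTransition_tendsto_indicator f hf0 x
  have key : ∀ n, ∫ x, G n x ∂μ = ∫ x, ρ x * G n x := fun n => h ((hGc n).toSchwartzMap (hGd n))
  have L1 : Tendsto (fun n => ∫ x, G n x ∂μ) atTop
      (𝓝 (∫ x, U.indicator (fun _ => (1 : ℂ)) x ∂μ)) :=
    tendsto_integral_of_dominated_convergence (fun _ => 1)
      (fun n => (hGd n).continuous.aestronglyMeasurable) (integrable_const 1)
      (fun n => ae_of_all _ (hG1 n)) (ae_of_all _ hlim)
  have L2 : Tendsto (fun n => ∫ x, ρ x * G n x) atTop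
      (𝓝 (∫ x, ρ x * U.indicator (fun _ => (1 : ℂ)) x)) := by
    refine tendsto_integral_of_dominated_convergence ((closure U).indicator fun x => ‖ρ x‖)
      (fun n => (hρ.mul (hGd n).continuous).aestronglyMeasurable) ?_ (fun n => ae_of_all _ ?_)
      (ae_of_all _ fun x => (hlim x).const_mul _)
    · exact (hρ.norm.continuousOn.integrableOn_compact hcl).integrable_indicator
        isClosed_closure.measurableSet
    · intro x
      by_cases hx : x ∈ closure U
      · rw [Set.indicator_of_mem hx, norm_mul]
        exact mul_le_of_le_one_right (norm_nonneg _) (hG1 n x)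
      · rw [hG0 n x fun hx' => hx (subset_closure hx')]
        simp [hx]
  have e := tendsto_nhds_unique (L1.congr key) L2
  rw [integral_indicator hU.measurableSet] at e
  have e3 : (fun x => ρ x * U.indicator (fun _ => (1 : ℂ)) x) = U.indicator ρ := by
    funext x; by_cases hx : x ∈ U <;> simp [hx]
  rw [e3, integral_indicator hU.measurableSet] at e
  simpa using e

end FourierInversion

/-! ### Pointwise positivity from positivity on balls -/

section Nonnegativity

open MeasureTheory Filter
open scoped Topology

/-- A continuous real function with non-negative integrals over all balls is non-negative. -/
lemma nonneg_of_setIntegral_ball_nonneg {X : Type*} [MetricSpace X] [ProperSpace X] [MeasurableSpace X]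
    [BorelSpace X] {ν : Measure X} [IsFiniteMeasureOnCompacts ν] [ν.IsOpenPosMeasure] {f : X → ℝ}
    (hf : Continuous f) (h : ∀ x r, 0 ≤ ∫ y in Metric.ball x r, f y ∂ν) (x : X) : 0 ≤ f x := by
  by_contra! hx
  -- If `f x < 0`, then `f` stays below the negative constant `f x / 2` on a small ball, and its
  -- integral there is negative.
  have hev : ∀ᶠ y in 𝓝 x, f y < f x / 2 := hf.continuousAt.eventually_lt_const (by linarith)
  obtain ⟨r, hr, hball⟩ := Metric.eventually_nhds_iff_ball.mp hev
  have hfin : ν (Metric.ball x r) < ⊤ := measure_ball_lt_top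
  have hle : ∫ y in Metric.ball x r, f y ∂ν ≤ ∫ _ in Metric.ball x r, f x / 2 ∂ν := by
    refine setIntegral_mono_on ?_ (integrableOn_const hfin.ne) measurableSet_ball
      fun y hy => (hball y hy).le
    exact (hf.continuousOn.integrableOn_compact (isCompact_closedBall x r)).mono_set
      Metric.ball_subset_closedBall
  rw [setIntegral_const, smul_eq_mul] at hle
  have hpos : 0 < ν.real (Metric.ball x r) :=
    ENNReal.toReal_pos (Metric.measure_ball_pos ν x hr).ne' hfin.ne
  have := h x r
  nlinarith

end Nonnegativity

/-! ### Smooth densities from compactly supported Fourier transforms -/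

section Density

open MeasureTheory Filter
open scoped FourierTransform RealInnerProductSpace Topology

variable {V : Type*} [NormedAddCommGroup V] [InnerProductSpace ℝ V] [FiniteDimensional ℝ V]
  [MeasurableSpace V] [BorelSpace V]

/-- A finite measure whose Fourier transform has compact support has a smooth integrable density. -/
lemma exists_smooth_density_of_measureFourier (μ : Measure V) [IsFiniteMeasure μ]
    (hF : HasCompactSupport (measureFourier μ)) :
    ∃ ρ : V → ℝ, ContDiff ℝ ∞ ρ ∧ Integrable ρ ∧
      ∀ I, MeasurableSet I → μ.real I = ∫ x in I, ρ x := by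
  have hFc := continuous_measureFourier μ
  have hd := contDiff_fourierInv_of_hasCompactSupport hFc hF
  set ρ₀ := 𝓕⁻ (measureFourier μ)
  -- Only local integrability is available here; global integrability follows once the density has
  -- been identified.
  have hint : ∀ U : Set V, Bornology.IsBounded U → IntegrableOn ρ₀ U := fun U hb =>
    (hd.continuous.continuousOn.integrableOn_compact hb.isCompact_closure).mono_set subset_closure
  have hρd : ContDiff ℝ ∞ fun x => (ρ₀ x).re := Complex.reCLM.contDiff.comp hd
  have hopen : ∀ U : Set V, IsOpen U → Bornology.IsBounded U →
      μ.real U = ∫ x in U, (ρ₀ x).re := by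
    intro U hU hb
    have := measureReal_eq_setIntegral_of_isOpen μ hd.continuous
      (integral_schwartz_eq_integral_fourierInv μ (hFc.integrable_of_hasCompactSupport hF)) hU hb
    have h2 := congrArg Complex.re this
    rw [Complex.ofReal_re] at h2
    rw [h2]
    exact (integral_re (𝕜 := ℂ) (hint U hb)).symm
  have hpos : ∀ x, 0 ≤ (ρ₀ x).re := nonneg_of_setIntegral_ball_nonneg (ν := volume) hρd.continuous
    fun x r => by rw [← hopen _ Metric.isOpen_ball Metric.isBounded_ball]; exact measureReal_nonneg
  -- The bounded open sets form a π-system that generates the Borel sets and contains the balls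
  -- exhausting `V`, so agreement on them suffices.
  have hμ : μ = volume.withDensity fun x => ENNReal.ofReal (ρ₀ x).re := by
    refine Measure.ext_of_generateFrom_of_iUnion {U : Set V | IsOpen U ∧ Bornology.IsBounded U}
      (fun n : ℕ => Metric.ball 0 n) ?_ ?_ (Metric.iUnion_ball_nat 0)
      (fun n => ⟨Metric.isOpen_ball, Metric.isBounded_ball⟩) (fun n => measure_ne_top _ _) ?_
    · rw [BorelSpace.measurable_eq (α := V)]
      refine le_antisymm ?_ (MeasurableSpace.generateFrom_mono fun U hU => hU.1)
      refine MeasurableSpace.generateFrom_le fun U hU => ?_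
      have : U = ⋃ n : ℕ, U ∩ Metric.ball 0 n := by
        rw [← Set.inter_iUnion, Metric.iUnion_ball_nat, Set.inter_univ]
      rw [this]
      exact MeasurableSet.iUnion fun n => MeasurableSpace.measurableSet_generateFrom
        ⟨IsOpen.inter hU Metric.isOpen_ball, Metric.isBounded_ball.subset Set.inter_subset_right⟩
    · rintro A ⟨hA, hAb⟩ B ⟨hB, -⟩ -
      exact ⟨hA.inter hB, hAb.subset Set.inter_subset_left⟩
    · rintro U ⟨hU, hb⟩
      rw [withDensity_apply _ hU.measurableSet,
        ← ofReal_integral_eq_lintegral_ofReal (f := fun x => (ρ₀ x).re) (hint U hb).re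
          (ae_of_all _ hpos), ← hopen U hU hb, ofReal_measureReal]
  -- The integral of this non-negative function is the total mass of `μ`.
  have hI : Integrable fun x => (ρ₀ x).re := by
    refine ⟨hρd.continuous.aestronglyMeasurable, ?_⟩
    rw [hasFiniteIntegral_iff_ofReal (ae_of_all _ hpos), ← setLIntegral_univ,
      ← withDensity_apply _ MeasurableSet.univ, ← hμ]
    exact measure_lt_top _ _
  refine ⟨fun x => (ρ₀ x).re, hρd, hI, fun I hIm => ?_⟩
  rw [integral_eq_lintegral_of_nonneg_ae (ae_of_all _ hpos) hρd.continuous.aestronglyMeasurable,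
    ← withDensity_apply _ hIm, ← hμ]
  rfl

end Density

/-! ### The measures of a positive-operator-valued measure, and the sign-reversal argument -/

section EffectMeasure

open MeasureTheory

variable {H : Type*} [NormedAddCommGroup H] [InnerProductSpace ℂ H]

namespace POVMeasure

variable (τ : POVMeasure H)

lemma inner_effect_symm {I : Set Spacetime} (hI : MeasurableSet I) (ψ φ : H) :
    inner ℂ (τ.effect I ψ) φ = inner ℂ ψ (τ.effect I φ) :=
  (τ.isPositive I hI).1 ψ φ

lemma inner_effect_nonneg {I : Set Spacetime} (hI : MeasurableSet I) (ψ : H) :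
    0 ≤ (inner ℂ ψ (τ.effect I ψ)).re := by
  rw [← τ.inner_effect_symm hI]
  exact (τ.isPositive I hI).2 ψ

lemma inner_effect_self_re {I : Set Spacetime} (hI : MeasurableSet I) (ψ : H) :
    (((inner ℂ ψ (τ.effect I ψ)).re : ℝ) : ℂ) = inner ℂ ψ (τ.effect I ψ) := by
  rw [← Complex.conj_eq_iff_re, inner_conj_symm, τ.inner_effect_symm hI]

/-- Countable additivity for a sequence of empty sets makes a constant series over `ℕ` summable,
which forces its term to vanish. -/
lemma inner_effect_empty (ψ : H) : inner ℂ ψ (τ.effect ∅ ψ) = 0 := by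
  have h := τ.hasSum_iUnion (fun _ => ∅) (fun _ => MeasurableSet.empty)
    (fun _ _ _ => Set.disjoint_empty _) ψ ψ
  exact (summable_const_iff (β := ℕ) _).mp h.summable

/-- The finite measure `I ↦ (ψ, τ(I) ψ)`. -/
noncomputable def diagMeasure (ψ : H) : Measure Spacetime :=
  Measure.ofMeasurable (fun I _ => ENNReal.ofReal (inner ℂ ψ (τ.effect I ψ)).re)
    (by rw [inner_effect_empty]; simp)
    (fun f hf hd => by
      have h := Complex.hasSum_re (τ.hasSum_iUnion f hf (fun _ _ hij => hd hij) ψ ψ)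
      rw [← h.tsum_eq, ENNReal.ofReal_tsum_of_nonneg (fun n => τ.inner_effect_nonneg (hf n) ψ)
        h.summable])

lemma diagMeasure_apply (ψ : H) {I : Set Spacetime} (hI : MeasurableSet I) :
    τ.diagMeasure ψ I = ENNReal.ofReal (inner ℂ ψ (τ.effect I ψ)).re :=
  Measure.ofMeasurable_apply I hI

instance isFiniteMeasure_diagMeasure (ψ : H) : IsFiniteMeasure (τ.diagMeasure ψ) :=
  ⟨by rw [diagMeasure_apply _ _ MeasurableSet.univ]; exact ENNReal.ofReal_lt_top⟩

lemma diagMeasure_real (ψ : H) {I : Set Spacetime} (hI : MeasurableSet I) :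
    (τ.diagMeasure ψ).real I = (inner ℂ ψ (τ.effect I ψ)).re := by
  rw [measureReal_def, diagMeasure_apply _ _ hI, ENNReal.toReal_ofReal (τ.inner_effect_nonneg hI ψ)]

lemma diagMeasure_real_univ (ψ : H) : (τ.diagMeasure ψ).real Set.univ = ‖ψ‖ ^ 2 := by
  rw [diagMeasure_real _ _ MeasurableSet.univ, τ.effect_univ, one_apply_eq_self,
    ← inner_self_eq_norm_sq (𝕜 := ℂ)]
  rfl

/-- Rescaling the two arguments of the real part of the sesquilinear form `(χ, τ(I) η)` inversely
does not change it. -/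
lemma diagMeasure_rescale (χ η : H) {s : ℝ} (hs : s ≠ 0) :
    τ.diagMeasure (χ + η) + τ.diagMeasure ((s : ℂ) • χ - (s⁻¹ : ℂ) • η) =
      τ.diagMeasure (χ - η) + τ.diagMeasure ((s : ℂ) • χ + (s⁻¹ : ℂ) • η) := by
  ext I hI
  simp only [Measure.add_apply, diagMeasure_apply _ _ hI]
  rw [← ENNReal.ofReal_add, ← ENNReal.ofReal_add]
  · congr 1
    rw [← Complex.add_re, ← Complex.add_re]
    congr 1
    have hs' : (s : ℂ) ≠ 0 := by exact_mod_cast hs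
    simp only [map_add, map_sub, map_smul, inner_add_left, inner_add_right, inner_sub_left,
      inner_sub_right, inner_smul_left, inner_smul_right, map_inv₀, Complex.conj_ofReal]
    field_simp
    ring
  all_goals exact τ.inner_effect_nonneg hI _

/-- By normalization of `τ` the measure has total mass `‖ψ‖ ^ 2`. This a priori bound starts the
iteration. -/
lemma norm_integral_diagMeasure_le {f : Spacetime → ℂ} (hf : ∀ x, ‖f x‖ ≤ 1) (ψ : H) :
    ‖∫ x, f x ∂(τ.diagMeasure ψ)‖ ≤ ‖ψ‖ ^ 2 := by
  have h := norm_integral_le_of_norm_le_const (μ := τ.diagMeasure ψ) (ae_of_all _ hf)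
  rwa [one_mul, diagMeasure_real_univ] at h

/-- The difference on the left is unchanged under `χ ↦ s χ`, `η ↦ s⁻¹ η`. After this rescaling both
terms are bounded by `hM` and added with the parallelogram law. The free parameter `s` allows a
short `η` to be balanced against a long `χ`. -/
lemma norm_integral_diagMeasure_add_sub_le {f : Spacetime → ℂ} (hfm : StronglyMeasurable f)
    (hf : ∀ x, ‖f x‖ ≤ 1) {M : ℝ} {E : Submodule ℂ H}
    (hM : ∀ ψ ∈ E, ‖∫ x, f x ∂(τ.diagMeasure ψ)‖ ≤ M * ‖ψ‖ ^ 2)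
    {χ η : H} (hχ : χ ∈ E) (hη : η ∈ E) {s : ℝ} (hs : 0 < s) :
    ‖∫ x, f x ∂(τ.diagMeasure (χ + η)) - ∫ x, f x ∂(τ.diagMeasure (χ - η))‖ ≤
      2 * M * (s ^ 2 * ‖χ‖ ^ 2 + s⁻¹ ^ 2 * ‖η‖ ^ 2) := by
  have hi : ∀ ψ, Integrable f (τ.diagMeasure ψ) := fun ψ =>
    (integrable_const (1 : ℝ)).mono' hfm.aestronglyMeasurable (ae_of_all _ hf)
  have h := congrArg (fun μ => ∫ x, f x ∂μ) (τ.diagMeasure_rescale χ η hs.ne')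
  simp only [integral_add_measure (hi _) (hi _)] at h
  have e : ∫ x, f x ∂(τ.diagMeasure (χ + η)) - ∫ x, f x ∂(τ.diagMeasure (χ - η)) =
      ∫ x, f x ∂(τ.diagMeasure ((s : ℂ) • χ + (s⁻¹ : ℂ) • η)) -
        ∫ x, f x ∂(τ.diagMeasure ((s : ℂ) • χ - (s⁻¹ : ℂ) • η)) := by
    linear_combination h
  have h1 := hM _ (E.add_mem (E.smul_mem (s : ℂ) hχ) (E.smul_mem (s⁻¹ : ℂ) hη))
  have h2 := hM _ (E.sub_mem (E.smul_mem (s : ℂ) hχ) (E.smul_mem (s⁻¹ : ℂ) hη))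
  have hpar := parallelogram_law_with_norm ℂ ((s : ℂ) • χ) ((s⁻¹ : ℂ) • η)
  rw [norm_smul, norm_smul, norm_inv, Complex.norm_real, Real.norm_of_nonneg hs.le] at hpar
  rw [e]
  refine (norm_sub_le _ _).trans ((add_le_add h1 h2).trans (le_of_eq ?_))
  linear_combination M * hpar

/-- If an isometry `U` that moves the vectors of an invariant subspace `E` by less than their
length inverts the sign of the form `ψ ↦ ∫ f d(ψ, τ ψ)`, then this form vanishes on `E`. -/
lemma integral_diagMeasure_eq_zero {f : Spacetime → ℂ} (hfm : StronglyMeasurable f)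
    (hf : ∀ x, ‖f x‖ ≤ 1) {E : Submodule ℂ H} (U : H →ₗᵢ[ℂ] H) {ε : ℝ} (hε0 : 0 < ε) (hε : ε < 1)
    (hUE : ∀ ψ ∈ E, U ψ ∈ E) (hU : ∀ ψ ∈ E, ‖U ψ - ψ‖ ≤ ε * ‖ψ‖)
    (hUf : ∀ ψ ∈ E, ∫ x, f x ∂(τ.diagMeasure (U ψ)) = -∫ x, f x ∂(τ.diagMeasure ψ))
    {ψ : H} (hψ : ψ ∈ E) : ∫ x, f x ∂(τ.diagMeasure ψ) = 0 := by
  -- Each round improves the bound by a factor `ε`. The bound is needed on all of `E`, since a round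
  -- applies it to combinations of `U ψ` and `ψ`.
  have key : ∀ n : ℕ, ∀ ψ ∈ E, ‖∫ x, f x ∂(τ.diagMeasure ψ)‖ ≤ ε ^ n * ‖ψ‖ ^ 2 := by
    intro n
    induction n with
    | zero => intro ψ _; simpa using τ.norm_integral_diagMeasure_le hf ψ
    | succ n ih =>
      intro ψ hψ
      have hχ : (2⁻¹ : ℂ) • (U ψ + ψ) ∈ E := E.smul_mem _ (E.add_mem (hUE ψ hψ) hψ)
      have hη : (2⁻¹ : ℂ) • (U ψ - ψ) ∈ E := E.smul_mem _ (E.sub_mem (hUE ψ hψ) hψ)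
      -- Here `‖χ‖ ≤ ‖ψ‖` and `‖η‖ ≤ (ε / 2) ‖ψ‖`; the choice `s ^ 2 = ε / 2` bounds each of the two
      -- terms by `(ε / 2) ‖ψ‖ ^ 2`.
      have h := τ.norm_integral_diagMeasure_add_sub_le hfm hf ih hχ hη
        (s := Real.sqrt (ε / 2)) (by positivity)
      have e1 : (2⁻¹ : ℂ) • (U ψ + ψ) + (2⁻¹ : ℂ) • (U ψ - ψ) = U ψ := by module
      have e2 : (2⁻¹ : ℂ) • (U ψ + ψ) - (2⁻¹ : ℂ) • (U ψ - ψ) = ψ := by module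
      rw [e1, e2, hUf ψ hψ, inv_pow, Real.sq_sqrt (by positivity), norm_smul, norm_smul] at h
      have h1 : ‖U ψ + ψ‖ ≤ 2 * ‖ψ‖ := by
        refine (norm_add_le _ _).trans ?_
        rw [U.norm_map]; linarith
      have h2 := hU ψ hψ
      have h3 : ‖U ψ + ψ‖ ^ 2 ≤ (2 * ‖ψ‖) ^ 2 := by gcongr
      have h4 : ‖U ψ - ψ‖ ^ 2 ≤ (ε * ‖ψ‖) ^ 2 := by gcongr
      -- The sign reversal makes the difference of the two integrals twice the integral to be
      -- estimated.
      have h5 : ‖-(∫ x, f x ∂(τ.diagMeasure ψ)) - ∫ x, f x ∂(τ.diagMeasure ψ)‖ =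
          2 * ‖∫ x, f x ∂(τ.diagMeasure ψ)‖ := by
        rw [← neg_add', norm_neg, ← two_mul, norm_mul]; simp
      have h6 : ε / 2 * (‖(2⁻¹ : ℂ)‖ * ‖U ψ + ψ‖) ^ 2 +
          (ε / 2)⁻¹ * (‖(2⁻¹ : ℂ)‖ * ‖U ψ - ψ‖) ^ 2 ≤ ε * ‖ψ‖ ^ 2 := by
        have h7 : (ε / 2)⁻¹ * ‖U ψ - ψ‖ ^ 2 ≤ (ε / 2)⁻¹ * (ε * ‖ψ‖) ^ 2 := by gcongr
        have h8 : (ε / 2)⁻¹ * (ε * ‖ψ‖) ^ 2 = 2 * ε * ‖ψ‖ ^ 2 := by field_simp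
        have h9 : ε * ‖U ψ + ψ‖ ^ 2 ≤ ε * (2 * ‖ψ‖) ^ 2 := by gcongr
        rw [norm_inv, Complex.norm_ofNat, mul_pow, mul_pow]
        linarith
      rw [h5] at h
      have h7 := mul_le_mul_of_nonneg_left h6 (show 0 ≤ 2 * ε ^ n by positivity)
      rw [pow_succ]
      linarith
  have hlim : Filter.Tendsto (fun n : ℕ => ε ^ n * ‖ψ‖ ^ 2) Filter.atTop (nhds (0 * ‖ψ‖ ^ 2)) :=
    (tendsto_pow_atTop_nhds_zero_of_lt_one hε0.le hε).mul_const _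
  rw [zero_mul] at hlim
  exact norm_le_zero_iff.mp (ge_of_tendsto' hlim fun n => key n ψ hψ)

end POVMeasure

end EffectMeasure

/-! ### Bounded momentum support and short translations -/

open MeasureTheory

variable {S : Type*}

/-- The state vectors whose momentum is supported in the ball of radius `R`. -/
noncomputable def momentumBall (Δ : S → ℕ → Set ℝ) (R : ℝ) : Submodule ℂ (StateSpace Δ) where
  carrier := {ψ | ∀ i, ∀ᵐ k ∂(spectralMeasure Δ i), R < ‖k‖ → ψ i k = 0}
  zero_mem' i := by
    filter_upwards [Lp.coeFn_zero (SpinSpace i.2) 2 (spectralMeasure Δ i)] with k hk _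
    exact hk
  add_mem' {ψ φ} hψ hφ i := by
    filter_upwards [hψ i, hφ i, Lp.coeFn_add (ψ i) (φ i)] with k h1 h2 h3 hk
    rw [lp.coeFn_add, Pi.add_apply, h3, Pi.add_apply, h1 hk, h2 hk, add_zero]
  smul_mem' c ψ hψ i := by
    filter_upwards [hψ i, Lp.coeFn_smul c (ψ i)] with k h1 h2 hk
    rw [lp.coeFn_smul, Pi.smul_apply, h2, Pi.smul_apply, h1 hk, smul_zero]

/-- Only finitely many components are non-zero, so the union of their compact supports is bounded
and one radius serves all labels. -/
lemma exists_mem_momentumBall {Δ : S → ℕ → Set ℝ} {ψ : StateSpace Δ} (hψ : ψ ∈ testDomain Δ) :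
    ∃ R, 0 < R ∧ ψ ∈ momentumBall Δ R := by
  obtain ⟨f, hf, hψf⟩ := hψ
  have hc : IsCompact (⋃ i ∈ {i | f i ≠ 0}, tsupport (f i)) :=
    hf.finite.isCompact_biUnion fun i _ => (hf.compact i).isCompact
  obtain ⟨R, hR, hsub⟩ := hc.isBounded.exists_pos_norm_le
  refine ⟨R, hR, fun i => ?_⟩
  filter_upwards [hψf i] with k hk hRk
  rw [hk]
  by_contra h0
  have hi : f i ≠ 0 := fun h => h0 (by rw [h]; rfl)
  exact hRk.not_ge (hsub k (Set.mem_biUnion hi (subset_tsupport _ h0)))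

/-- For `b = 1` the wave function is evaluated at the boost itself, so no spin rotation remains and
a translation multiplies by a plane wave. -/
lemma coeFn_poincareU_one (Δ : S → ℕ → Set ℝ) (x : Spacetime) (ψ : StateSpace Δ) (i : S × ℕ) :
    poincareU Δ x 1 ψ i =ᵐ[spectralMeasure Δ i]
      fun k => Complex.exp (Complex.I * (mink k x : ℝ)) • ψ i k := by
  filter_upwards [coeFn_poincareU Δ x 1 ψ i, ae_mem_futureCone Δ i] with k h hk
  rw [h, poincareAct, inv_one, Matrix.SpecialLinearGroup.coe_one, Matrix.one_mul,
    waveOnGroup_boost _ _ hk]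

lemma poincareU_one_mem_momentumBall {Δ : S → ℕ → Set ℝ} {R : ℝ} (x : Spacetime)
    {ψ : StateSpace Δ} (hψ : ψ ∈ momentumBall Δ R) : poincareU Δ x 1 ψ ∈ momentumBall Δ R := by
  intro i
  filter_upwards [hψ i, coeFn_poincareU_one Δ x ψ i] with k h1 h2 hk
  rw [h2, h1 hk, smul_zero]

/-- On the momentum support `|exp(i k · x) - 1| ≤ |k · x| ≤ ε`; elsewhere the wave function
vanishes. Comparing with `ε • ψ` component by component passes the pointwise bound to the Hilbert
sum. -/
lemma norm_poincareU_one_sub_le {Δ : S → ℕ → Set ℝ} {R ε : ℝ} (hε : 0 ≤ ε) {x : Spacetime}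
    (hx : ∀ k : Spacetime, ‖k‖ ≤ R → |mink k x| ≤ ε) {ψ : StateSpace Δ}
    (hψ : ψ ∈ momentumBall Δ R) : ‖poincareU Δ x 1 ψ - ψ‖ ≤ ε * ‖ψ‖ := by
  have h : ∀ i, ‖(poincareU Δ x 1 ψ - ψ) i‖ ≤ ‖((ε : ℂ) • ψ) i‖ := by
    intro i
    rw [lp.coeFn_smul, Pi.smul_apply, norm_smul, Complex.norm_real, Real.norm_of_nonneg hε,
      lp.coeFn_sub, Pi.sub_apply]
    refine Lp.norm_le_mul_norm_of_ae_le_mul ?_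
    filter_upwards [hψ i, coeFn_poincareU_one Δ x ψ i,
      Lp.coeFn_sub (poincareU Δ x 1 ψ i) (ψ i)] with k h1 h2 h3
    rw [h3, Pi.sub_apply, h2]
    by_cases hk : R < ‖k‖
    · rw [h1 hk]; simp
    · have e : Complex.exp (Complex.I * (mink k x : ℝ)) • ψ i k - ψ i k =
          (Complex.exp (Complex.I * (mink k x : ℝ)) - 1) • ψ i k := by module
      rw [e, norm_smul]
      gcongr
      exact (Real.norm_exp_I_mul_ofReal_sub_one_le).trans (hx k (not_lt.mp hk))
  refine (lp.norm_mono (by norm_num) h).trans ?_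
  rw [norm_smul, Complex.norm_real, Real.norm_of_nonneg hε]

/-- The norm on `Spacetime` is the supremum norm, so each of the four products is at most `‖k‖ *
‖x‖`. -/
lemma abs_mink_le (k x : Spacetime) : |mink k x| ≤ 4 * (‖k‖ * ‖x‖) := by
  have h : ∀ i, |k i * x i| ≤ ‖k‖ * ‖x‖ := fun i => by
    rw [abs_mul]
    exact mul_le_mul (norm_le_pi_norm k i) (norm_le_pi_norm x i) (abs_nonneg _) (norm_nonneg _)
  have h0 := abs_le.mp (h 0)
  have h1 := abs_le.mp (h 1)
  have h2 := abs_le.mp (h 2)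
  have h3 := abs_le.mp (h 3)
  rw [mink, abs_le]
  constructor <;> linarith

/-! ### Consequences of covariance, and existence of densities -/

section Covariance

variable {Δ : S → ℕ → Set ℝ} {τ : POVMeasure (StateSpace Δ)}

/-- Covariance with `b = 1`, applied to the translate of `J` by `-x`, moves both factors `U` onto
the effect. -/
lemma IsPoincareCovariant.diagMeasure_translate (hτ : IsPoincareCovariant τ) (x : Spacetime)
    (ψ : StateSpace Δ) :
    τ.diagMeasure (poincareU Δ x 1 ψ) = (τ.diagMeasure ψ).map (fun y => y + x) := by
  ext J hJ
  have hm : Measurable fun y : Spacetime => y + x := measurable_id.add_const x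
  have hI := hm hJ
  rw [Measure.map_apply hm hJ, τ.diagMeasure_apply _ hJ, τ.diagMeasure_apply _ hI]
  have himg : (fun y => lorentz ((1 : SL2C) : Mat2) *ᵥ y + x) '' ((fun y => y + x) ⁻¹' J) = J := by
    simp only [Matrix.SpecialLinearGroup.coe_one, lorentz_one, Matrix.one_mulVec]
    exact Set.image_preimage_eq J (add_right_surjective x)
  have h := hτ x 1 _ hI
  rw [himg] at h
  rw [← h, ContinuousLinearMap.comp_apply, ContinuousLinearMap.adjoint_inner_right]
  rfl

/-- The phase function `y ↦ exp(-2πi ⟪y, ξ⟫)`. -/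
noncomputable def phase (ξ : EuclideanSpace ℝ (Fin 4)) (y : Spacetime) : ℂ :=
  Real.fourierChar (-inner ℝ (WithLp.toLp 2 y) ξ)

lemma continuous_phase (ξ : EuclideanSpace ℝ (Fin 4)) : Continuous (phase ξ) := by
  unfold phase
  have h1 := Real.continuous_fourierChar
  have h2 := PiLp.continuous_toLp 2 (fun _ : Fin 4 => ℝ)
  fun_prop

lemma norm_phase (ξ : EuclideanSpace ℝ (Fin 4)) (y : Spacetime) : ‖phase ξ y‖ = 1 :=
  Circle.norm_coe _

lemma phase_add (ξ : EuclideanSpace ℝ (Fin 4)) (y x : Spacetime) :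
    phase ξ (y + x) = phase ξ x * phase ξ y := by
  rw [phase, WithLp.toLp_add, inner_add_left, neg_add_rev, AddChar.map_add_eq_mul, Circle.coe_mul]
  rfl

/-- The vector `ξ / (2 ‖ξ‖ ^ 2)` has scalar product `1 / 2` with `ξ`, and its length `1 / (2 ‖ξ‖)`
is small for large `ξ`. -/
lemma phase_half_period {ξ : EuclideanSpace ℝ (Fin 4)} (hξ : ξ ≠ 0) :
    phase ξ ((2 * ‖ξ‖ ^ 2)⁻¹ • ξ).ofLp = -1 := by
  have hn : ‖ξ‖ ≠ 0 := norm_ne_zero_iff.mpr hξ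
  rw [phase, WithLp.toLp_ofLp, real_inner_smul_left, real_inner_self_eq_norm_sq,
    Real.fourierChar_apply, show -((2 * ‖ξ‖ ^ 2)⁻¹ * ‖ξ‖ ^ 2) = -(1 / 2 : ℝ) by field_simp]
  rw [show (((2 * Real.pi * -(1 / 2 : ℝ) : ℝ) : ℂ) * Complex.I) = -(Real.pi * Complex.I) by
    push_cast; ring, Complex.exp_neg, Complex.exp_pi_mul_I]
  norm_num

/-- The measure `(ψ, τ(·) ψ)` of a state with momentum in a ball has a Fourier transform
supported in a ball. -/
lemma IsPoincareCovariant.integral_phase_eq_zero (hτ : IsPoincareCovariant τ) {R : ℝ} (hR : 0 < R)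
    {ψ : StateSpace Δ} (hψ : ψ ∈ momentumBall Δ R) {ξ : EuclideanSpace ℝ (Fin 4)}
    (hξ : 2 * R < ‖ξ‖) : ∫ y, phase ξ y ∂(τ.diagMeasure ψ) = 0 := by
  have hn : 0 < ‖ξ‖ := by linarith
  have hξ0 : ξ ≠ 0 := norm_pos_iff.mp hn
  set x : Spacetime := ((2 * ‖ξ‖ ^ 2)⁻¹ • ξ).ofLp with hx
  -- The supremum norm of `x` is at most its Euclidean norm.
  have hxn : ‖x‖ ≤ (2 * ‖ξ‖)⁻¹ := by
    have h1 : ‖((2 * ‖ξ‖ ^ 2)⁻¹ • ξ)‖ = (2 * ‖ξ‖)⁻¹ := by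
      rw [norm_smul, Real.norm_of_nonneg (by positivity)]
      field_simp
    rw [← h1]
    exact (pi_norm_le_iff_of_nonneg (norm_nonneg _)).mpr fun i => PiLp.norm_apply_le _ i
  -- The bound is `4 * R / (2 * ‖ξ‖)`, which is less than `1` precisely when `‖ξ‖ > 2 * R`.
  have hbound : ∀ k : Spacetime, ‖k‖ ≤ R → |mink k x| ≤ 2 * R / ‖ξ‖ := by
    intro k hk
    refine (abs_mink_le k x).trans ?_
    have : ‖k‖ * ‖x‖ ≤ R * (2 * ‖ξ‖)⁻¹ := by gcongr
    refine (mul_le_mul_of_nonneg_left this (by norm_num)).trans (le_of_eq ?_)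
    field_simp
    norm_num
  refine τ.integral_diagMeasure_eq_zero (continuous_phase ξ).stronglyMeasurable
    (fun y => (norm_phase ξ y).le) (poincareU Δ x 1) (ε := 2 * R / ‖ξ‖) (by positivity)
    (by rwa [div_lt_one hn]) (fun φ hφ => poincareU_one_mem_momentumBall x hφ)
    (fun φ hφ => norm_poincareU_one_sub_le (by positivity) hbound hφ) (fun φ _ => ?_) hψ
  rw [hτ.diagMeasure_translate, integral_map (by fun_prop)
    (continuous_phase ξ).aestronglyMeasurable, ← integral_neg]
  simp only [phase_add, hx, phase_half_period hξ0, neg_one_mul]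

/-- Fourier inversion needs an inner product, whereas `Spacetime` carries the supremum norm. The
measure is therefore pushed to `EuclideanSpace` by `WithLp.toLp`, which preserves Lebesgue measure,
and the density is pulled back. -/
lemma IsPoincareCovariant.exists_diagonal_density (hτ : IsPoincareCovariant τ) {ψ : StateSpace Δ}
    (hψ : ψ ∈ testDomain Δ) :
    ∃ ρ : Spacetime → ℝ, ContDiff ℝ ∞ ρ ∧ Integrable ρ ∧
      ∀ I, MeasurableSet I → inner ℂ ψ (τ.effect I ψ) = ((∫ x in I, ρ x : ℝ) : ℂ) := by
  obtain ⟨R, hR, hmem⟩ := exists_mem_momentumBall hψ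
  have hvp := PiLp.volume_preserving_toLp (Fin 4)
  have hme : MeasurableEmbedding (WithLp.toLp 2 : Spacetime → EuclideanSpace ℝ (Fin 4)) :=
    (MeasurableEquiv.toLp 2 Spacetime).measurableEmbedding
  set ν := (τ.diagMeasure ψ).map (WithLp.toLp 2 : Spacetime → EuclideanSpace ℝ (Fin 4))
  have : IsFiniteMeasure ν := Measure.isFiniteMeasure_map _ _
  have hF : HasCompactSupport (measureFourier ν) := by
    refine HasCompactSupport.intro (isCompact_closedBall 0 (2 * R)) fun ξ hξ => ?_
    rw [measureFourier_eq, hme.integral_map]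
    exact hτ.integral_phase_eq_zero hR hmem (by simpa using hξ)
  obtain ⟨ρ, hd, hi, hI⟩ := exists_smooth_density_of_measureFourier ν hF
  refine ⟨fun x => ρ (WithLp.toLp 2 x), hd.comp (PiLp.contDiff_toLp), ?_, fun I hIm => ?_⟩
  · exact (hvp.integrable_comp_emb hme).mpr hi
  · have hpre := hme.injective.preimage_image I
    have hIm' := hme.measurableSet_image.mpr hIm
    rw [← τ.inner_effect_self_re hIm, ← τ.diagMeasure_real ψ hIm]
    have h := hI _ hIm'
    rw [← hvp.setIntegral_preimage_emb hme, hpre, measureReal_def, hme.map_apply, hpre] at h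
    rw [← h]
    rfl

lemma IsPoincareCovariant.exists_density (hτ : IsPoincareCovariant τ) {ψ φ : StateSpace Δ}
    (hψ : ψ ∈ testDomain Δ) (hφ : φ ∈ testDomain Δ) :
    ∃ ρ : Spacetime → ℂ, ContDiff ℝ ∞ ρ ∧ Integrable ρ ∧
      ∀ I, MeasurableSet I → inner ℂ ψ (τ.effect I φ) = ∫ x in I, ρ x := by
  have key : ∀ χ ∈ testDomain Δ, ∃ ρ : Spacetime → ℂ, ContDiff ℝ ∞ ρ ∧ Integrable ρ ∧
      ∀ I, MeasurableSet I → inner ℂ χ (τ.effect I χ) = ∫ x in I, ρ x := by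
    intro χ hχ
    obtain ⟨ρ, hd, hi, hI⟩ := hτ.exists_diagonal_density hχ
    exact ⟨fun x => (ρ x : ℂ), Complex.ofRealCLM.contDiff.comp hd, hi.ofReal, fun I hIm => by
      rw [hI I hIm]; exact integral_ofReal.symm⟩
  have hIφ := (testDomain Δ).smul_mem Complex.I hφ
  obtain ⟨ρ₁, hd₁, hi₁, h₁⟩ := key _ ((testDomain Δ).add_mem hψ hφ)
  obtain ⟨ρ₂, hd₂, hi₂, h₂⟩ := key _ ((testDomain Δ).sub_mem hψ hφ)
  obtain ⟨ρ₃, hd₃, hi₃, h₃⟩ := key _ ((testDomain Δ).add_mem hψ hIφ)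
  obtain ⟨ρ₄, hd₄, hi₄, h₄⟩ := key _ ((testDomain Δ).sub_mem hψ hIφ)
  -- Polarization for a form that is conjugate-linear in its first argument: the differences for `ψ
  -- ± φ` and for `ψ ± iφ` combine with weights `1 / 4` and `-i / 4`.
  refine ⟨fun x => 4⁻¹ * (ρ₁ x - ρ₂ x - Complex.I * (ρ₃ x - ρ₄ x)), ?_, ?_, fun I hIm => ?_⟩
  · exact contDiff_const.mul ((hd₁.sub hd₂).sub (contDiff_const.mul (hd₃.sub hd₄)))
  · exact ((hi₁.sub hi₂).sub ((hi₃.sub hi₄).const_mul _)).const_mul _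
  · have e12 : ∫ x in I, (ρ₁ x - ρ₂ x) = (∫ x in I, ρ₁ x) - ∫ x in I, ρ₂ x :=
      integral_sub hi₁.integrableOn hi₂.integrableOn
    have e34 : ∫ x in I, (ρ₃ x - ρ₄ x) = (∫ x in I, ρ₃ x) - ∫ x in I, ρ₄ x :=
      integral_sub hi₃.integrableOn hi₄.integrableOn
    have e : ∫ x in I, (ρ₁ x - ρ₂ x - Complex.I * (ρ₃ x - ρ₄ x)) =
        (∫ x in I, (ρ₁ x - ρ₂ x)) - ∫ x in I, Complex.I * (ρ₃ x - ρ₄ x) :=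
      integral_sub (hi₁.sub hi₂).integrableOn ((hi₃.sub hi₄).const_mul _).integrableOn
    rw [integral_const_mul, e, integral_const_mul, e12, e34, ← h₁ I hIm, ← h₂ I hIm, ← h₃ I hIm,
      ← h₄ I hIm]
    simp only [map_add, map_sub, map_smul, inner_add_left, inner_add_right, inner_sub_left,
      inner_sub_right, inner_smul_left, inner_smul_right, Complex.conj_I]
    linear_combination
      (1 / 2) * (inner ℂ ψ (τ.effect I φ) - inner ℂ φ (τ.effect I ψ)) * Complex.I_sq

end Covariance

/-- A continuous complex density of a non-negative quantity is real and non-negative. -/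
lemma density_im_eq_zero_and_re_nonneg {ρ : Spacetime → ℂ} (hc : Continuous ρ) (hi : Integrable ρ)
    (h : ∀ I, MeasurableSet I → (∫ x in I, ρ x).im = 0 ∧ 0 ≤ (∫ x in I, ρ x).re) (x : Spacetime) :
    (ρ x).im = 0 ∧ 0 ≤ (ρ x).re := by
  have hre : ∀ I, ∫ x in I, (ρ x).re = (∫ x in I, ρ x).re := fun I =>
    integral_re (𝕜 := ℂ) hi.integrableOn
  have him : ∀ I, ∫ x in I, (ρ x).im = (∫ x in I, ρ x).im := fun I =>
    integral_im (𝕜 := ℂ) hi.integrableOn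
  -- The imaginary part has zero integral over every ball, so the positivity criterion applies to it
  -- and to its negative.
  have h1 : 0 ≤ (ρ x).im := nonneg_of_setIntegral_ball_nonneg (ν := volume)
    (Complex.continuous_im.comp hc)
    (fun y r => ((him _).trans (h _ measurableSet_ball).1).ge) x
  have h2 : 0 ≤ -(ρ x).im := nonneg_of_setIntegral_ball_nonneg (ν := volume)
    (Complex.continuous_im.comp hc).neg
    (fun y r => by
      refine ge_of_eq ((integral_neg _).trans ?_)
      exact (neg_eq_zero.mpr ((him _).trans (h _ measurableSet_ball).1))) x
  exact ⟨by linarith, nonneg_of_setIntegral_ball_nonneg (ν := volume)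
    (Complex.continuous_re.comp hc)
    (fun y r => (h _ measurableSet_ball).2.trans_eq (hre _).symm) x⟩

end QEvent

/-! ### The proposition -/

theorem proposition2 {S : Type*} [Countable S] (Δ : S → ℕ → Set ℝ)
    (hΔ : ∀ σ n, MeasurableSet (Δ σ n))
    (τ : QEvent.POVMeasure (QEvent.StateSpace Δ)) (hτ : QEvent.IsPoincareCovariant τ) :
    ∃ ρ : QEvent.testDomain Δ → QEvent.testDomain Δ → QEvent.Spacetime → ℂ,
      (∀ ψ φ : QEvent.testDomain Δ,
        ContDiff ℝ ∞ (ρ ψ φ) ∧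
        MeasureTheory.Integrable (ρ ψ φ) ∧
        ∀ I : Set QEvent.Spacetime, MeasurableSet I →
          inner ℂ (ψ : QEvent.StateSpace Δ) (τ.effect I (φ : QEvent.StateSpace Δ)) =
            ∫ x in I, ρ ψ φ x) ∧
      ∀ (ψ : QEvent.testDomain Δ) (x : QEvent.Spacetime),
        (ρ ψ ψ x).im = 0 ∧ 0 ≤ (ρ ψ ψ x).re := by
  choose ρ hd hi hI using fun ψ φ : QEvent.testDomain Δ => hτ.exists_density ψ.2 φ.2
  refine ⟨ρ, fun ψ φ => ⟨hd ψ φ, hi ψ φ, hI ψ φ⟩, fun ψ x => ?_⟩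
  -- The densities are chosen separately for each pair; on the diagonal, continuity and positivity
  -- of `τ` make any such choice real and non-negative at every point.
  refine QEvent.density_im_eq_zero_and_re_nonneg (hd ψ ψ).continuous (hi ψ ψ) (fun I hIm => ?_) x
  rw [← hI ψ ψ I hIm]
  refine ⟨?_, τ.inner_effect_nonneg hIm _⟩
  rw [← τ.inner_effect_self_re hIm, Complex.ofReal_im]
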